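/- **Theorem 1.1 (quantile Brascamp–Lieb type inequality).** There exists a universal constant $C>0$ such that the following holds for every $n\ge 1$. Let $f:\mathbb{R}^n\to(-\infty,\infty]$ be convex, let $X$ be a random vector in $\mathbb{R}^n$ with density $\exp(-f)$ with respect to Lebesgue measure, and let $\eta\in\mathbb{R}^n$ be a non-zero vector. Here $(\operatorname{Hess} f)(x)$ is the unique symmetric matrix for which the expansion $$f(x+y)=f(x)+\langle y,v\rangle+\tfrac12\langle y,(\operatorname{Hess} f)(x)\,y\rangle+o(\|y\|^2)\qquad(y\to 0)$$ is valid, with finite values of $f$ near $x$, for some vector $v$; by Aleksandrov's theorem it exists and is positive semidefinite for almost every $x$ with $f(x)<\infty$. For a symmetric positive semidefinite matrix $H$, possibly singular, $\langle\eta,H^{-1}\eta\rangle\in[0,\infty]$ denotes $\langle\eta,\zeta\rangle$ for any $\zeta$ with $H\zeta=\eta$ if $\eta$ is orthogonal to the kernel of $H$ (the value does not depend on $\zeta$), and $\infty$ otherwise. Set $Y:=\langle\eta,(\operatorname{Hess} f)(X)^{-1}\eta\rangle\in[0,\infty]$, which is defined almost surely. Then, for each real $t>0$, $$\operatorname{Var}(\langle\eta,X\rangle)\le\frac{C\,t}{\mathbb{P}(Y\le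 t)^{3}},$$ where the right-hand side is read as $+\infty$ if $\mathbb{P}(Y\le t)=0$. In particular, with the same constant $C$, $$\operatorname{Var}(\langle\eta,X\rangle)\le 8C\,m$$ for every median $m$ of $Y$, that is, every $m\in[0,\infty]$ with $\mathbb{P}(Y\ge m)\ge\frac12$ and $\mathbb{P}(Y\le m)\ge\frac12$. -/

import Mathlib

open MeasureTheory ProbabilityTheory Asymptotics
open scoped NNReal ENNReal Topology

/-- `f : ℝⁿ → (-∞, ∞]` is convex: it never takes the value `-∞` and satisfies the convexity
inequality in the extended reals (for positive weights, so that `∞` is only multiplied by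
positive numbers). -/
def IsExtendedConvex {n : ℕ} (f : EuclideanSpace ℝ (Fin n) → EReal) : Prop :=
  (∀ x, f x ≠ ⊥) ∧
    ∀ x y : EuclideanSpace ℝ (Fin n), ∀ a b : ℝ, 0 < a → 0 < b → a + b = 1 →
      f (a • x + b • y) ≤ (a : EReal) * f x + (b : EReal) * f y

/-- The random vector `X` has the density `exp (-f)` with respect to Lebesgue measure on `ℝⁿ`
(where `exp (-∞) = 0`). -/
def HasDensityExpNeg {Ω : Type*} [MeasurableSpace Ω] (P : Measure Ω) {n : ℕ}
    (X : Ω → EuclideanSpace ℝ (Fin n)) (f : EuclideanSpace ℝ (Fin n) → EReal) : Prop :=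
  AEMeasurable X P ∧ P.map X = volume.withDensity (fun x => EReal.exp (-f x))

/-- `H` is the Hessian matrix of `f` at `x`: it is symmetric, `f` is finite near `x`, and
`f (x + y) = f x + ⟨y, v⟩ + ⟨y, H y⟩ / 2 + o(‖y‖²)` as `y → 0`, for some vector `v`. -/
def HasHessianMatrixAt {n : ℕ} (f : EuclideanSpace ℝ (Fin n) → EReal)
    (x : EuclideanSpace ℝ (Fin n)) (H : Matrix (Fin n) (Fin n) ℝ) : Prop :=
  H.IsSymm ∧ (∀ᶠ z in 𝓝 x, f z ≠ ⊤ ∧ f z ≠ ⊥) ∧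
    ∃ v : EuclideanSpace ℝ (Fin n),
      (fun y : EuclideanSpace ℝ (Fin n) =>
          (f (x + y)).toReal - ((f x).toReal + inner ℝ y v
            + 1 / 2 * inner ℝ y (Matrix.toEuclideanLin H y)))
        =o[𝓝 0] fun y => ‖y‖ ^ 2

/-- `⟨η, H⁻¹ η⟩ ∈ [0, ∞]` for a symmetric positive semidefinite, possibly singular matrix `H`.
If `η` is orthogonal to the kernel of `H`, that is, `η = H ζ` for some `ζ`, this is `⟨η, ζ⟩`,
which does not depend on the choice of `ζ`. Otherwise the infimum is empty and the value
is `∞`. -/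
noncomputable def invQuadForm {n : ℕ} (H : Matrix (Fin n) (Fin n) ℝ)
    (η : EuclideanSpace ℝ (Fin n)) : ℝ≥0∞ :=
  ⨅ (ζ : EuclideanSpace ℝ (Fin n)) (_ : Matrix.toEuclideanLin H ζ = η),
    ENNReal.ofReal (inner ℝ η ζ)

/-- `⟨η, (Hess f)(x)⁻¹ η⟩ ∈ [0, ∞]`. There is at most one Hessian matrix of `f` at `x`, so the
infimum is over at most one matrix. Where `f` has no Hessian matrix (for convex `f`, a Lebesgue
null subset of `{f < ∞}`, together with `{f = ∞}`), the value is `∞` by convention. -/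
noncomputable def invHessForm {n : ℕ} (f : EuclideanSpace ℝ (Fin n) → EReal)
    (η x : EuclideanSpace ℝ (Fin n)) : ℝ≥0∞ :=
  ⨅ (H : Matrix (Fin n) (Fin n) ℝ) (_ : HasHessianMatrixAt f x H), invQuadForm H η

/-- `m ∈ [0, ∞]` is a median of the `[0, ∞]`-valued random variable `Y`. -/
def IsMedian {Ω : Type*} [MeasurableSpace Ω] (P : Measure Ω) (Y : Ω → ℝ≥0∞) (m : ℝ≥0∞) : Prop :=
  1 / 2 ≤ P {ω | m ≤ Y ω} ∧ 1 / 2 ≤ P {ω | Y ω ≤ m}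

/-! Integrate the density over the hyperplanes orthogonal to `η`. By Prékopa–Leindler the resulting
marginal `F` on the line is log-concave, and a log-concave probability density with supremum `M` has
variance `O(1 / M²)`. So it suffices to bound `M` from below.

Where `⟨η, (Hess f)⁻¹ η⟩ ≤ t`, Cauchy–Schwarz bounds the Hessian below by a multiple of `⟨η, ·⟩² /
t`, so midpoint log-concavity of the density improves there by a factor `exp (-κ ⟨η, u⟩²)`, with `κ`
of order `1 / t`. Applying Prékopa–Leindler with a target lowered on this good set transfers the
gain to the marginal (`sliceIntegral_midpoint_gain`): heuristically, `-(log F)''` is at least a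
multiple of `κ ‖η‖² q / F ≥ κ ‖η‖² q / M`, where `q` is the marginal of the good mass. Integrate
between two points that cut off small tails. The good mass between them is comparable to its total
`p`, while the slopes of `log F` there are `O(M / p)`, because a steep log-concave function has a
small tail. Hence `κ ‖η‖² p² = O(M²)` (`IsLogConcave.mul_sq_le_of_midpoint_gain`), and the variance
is `O(t / p²)`. This is stronger than the cubic bound, since `p ≤ 1`.

The Hessian expansion is only local and gives nothing in directions orthogonal to `η`, whereas
slices involve arbitrarily large increments. A small Gaussian factor `exp (-δ ‖x‖² / 2)` repairs
this: it absorbs the error `o(‖u‖²)` for small `u` and supplies the whole gain for large `u`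
(`exists_mem_gainSet`). The bound on `M` does not depend on `δ`. -/

/-! ### Brunn–Minkowski on the line and Prékopa–Leindler. -/

theorem volume_image_affine (a c : ℝ) (ha : 0 < a) (K : Set ℝ) :
    volume ((fun x => a * x + c) '' K) = ENNReal.ofReal a * volume K := by
  have : (fun x => a * x + c) '' K = (fun x => x + c) '' ((fun x => a * x) '' K) := by
    rw [Set.image_image]
  rw [this, Set.image_add_right, measure_preimage_add_right]
  have := Measure.addHaar_image_linearMap (volume : Measure ℝ) (LinearMap.mulLeft ℝ a) K
  rwa [LinearMap.det_ring, LinearMap.mulLeft_apply, mul_one, abs_of_pos ha] at this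

/-- The sets `a K + b min L` and `a max K + b L` both lie in `S` and meet in at most the single
point `a max K + b min L`, so their measures add up. -/
theorem brunnMinkowski_compact {K L S : Set ℝ} (hK : IsCompact K) (hL : IsCompact L)
    (hK0 : K.Nonempty) (hL0 : L.Nonempty) {a b : ℝ} (ha : 0 < a) (hb : 0 < b)
    (h : ∀ x ∈ K, ∀ y ∈ L, a * x + b * y ∈ S) :
    ENNReal.ofReal a * volume K + ENNReal.ofReal b * volume L ≤ volume S := by
  obtain ⟨x₀, hx₀, hx⟩ := hK.exists_isGreatest hK0
  obtain ⟨y₀, hy₀, hy⟩ := hL.exists_isLeast hL0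
  rw [← volume_image_affine a (b * y₀) ha, ← volume_image_affine b (a * x₀) hb,
    ← measure_union₀]
  · apply measure_mono
    rintro z (⟨x, hxK, rfl⟩ | ⟨y, hyL, rfl⟩)
    · exact h x hxK y₀ hy₀
    · simpa only [add_comm] using h x₀ hx₀ y hyL
  · exact (hL.image (by fun_prop)).measurableSet.nullMeasurableSet
  · refine measure_mono_null (t := {a * x₀ + b * y₀}) ?_ (by simp)
    rintro z ⟨⟨x, hxK, rfl⟩, ⟨y, hyL, hz⟩⟩
    have h1 := mul_le_mul_of_nonneg_left (hx hxK) ha.le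
    have h2 := mul_le_mul_of_nonneg_left (hy hyL) hb.le
    simp only at hz
    simp only [Set.mem_singleton_iff]
    linarith

/-- The Brunn–Minkowski inequality on the real line. -/
theorem brunnMinkowski_real {A B S : Set ℝ} (hA : MeasurableSet A) (hB : MeasurableSet B)
    (hA0 : A.Nonempty) (hB0 : B.Nonempty) {a b : ℝ} (ha : 0 < a) (hb : 0 < b)
    (h : ∀ x ∈ A, ∀ y ∈ B, a * x + b * y ∈ S) :
    ENNReal.ofReal a * volume A + ENNReal.ofReal b * volume B ≤ volume S := by
  obtain ⟨x₀, hx₀⟩ := hA0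
  obtain ⟨y₀, hy₀⟩ := hB0
  rw [hA.measure_eq_iSup_isCompact, hB.measure_eq_iSup_isCompact]
  simp only [ENNReal.mul_iSup, iSup_and']
  refine ENNReal.biSup_add_biSup_le' ⟨∅, by simp⟩ ⟨∅, by simp⟩ fun K hK L hL => ?_
  -- Inserting a point keeps the approximating compact sets nonempty.
  have := brunnMinkowski_compact (hK.2.insert x₀) (hL.2.insert y₀) (Set.insert_nonempty _ _)
    (Set.insert_nonempty _ _) ha hb
    (fun x hx y hy => h x (Set.insert_subset hx₀ hK.1 hx) y (Set.insert_subset hy₀ hL.1 hy))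
  refine le_trans ?_ this
  gcongr <;> exact Set.subset_insert _ _

theorem ENNReal.rpow_mul_rpow_le_add {a b : ℝ} (ha : 0 < a) (hb : 0 < b) (hab : a + b = 1)
    (x y : ℝ≥0∞) : x ^ a * y ^ b ≤ ENNReal.ofReal a * x + ENNReal.ofReal b * y := by
  rcases eq_or_ne x ⊤ with rfl | hx
  · simp [ha]
  rcases eq_or_ne y ⊤ with rfl | hy
  · simp [hb]
  lift x to ℝ≥0 using hx
  lift y to ℝ≥0 using hy
  have := NNReal.geom_mean_le_arith_mean2_weighted ⟨a, ha.le⟩ ⟨b, hb.le⟩ x y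
    (NNReal.eq hab)
  rw [← ENNReal.coe_rpow_of_nonneg _ ha.le, ← ENNReal.coe_rpow_of_nonneg _ hb.le,
    ENNReal.ofReal_eq_coe_nnreal ha.le, ENNReal.ofReal_eq_coe_nnreal hb.le]
  exact_mod_cast this

/-- Superlevel sets of three functions normalised to have supremum `1`. -/
theorem prekopaLeindler_normalized {f g h : ℝ → ℝ} (hf : Measurable f) (hg : Measurable g)
    (hh : Measurable h) (hf0 : ∀ x, 0 ≤ f x) (hg0 : ∀ x, 0 ≤ g x) (hh0 : ∀ x, 0 ≤ h x)
    (hf1 : ∀ x, f x ≤ 1) (hg1 : ∀ x, g x ≤ 1)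
    (hfs : ∀ t < 1, ∃ x, t < f x) (hgs : ∀ t < 1, ∃ x, t < g x)
    {a b : ℝ} (ha : 0 < a) (hb : 0 < b)
    (H : ∀ x y t, 0 < t → t < f x → t < g y → t < h (a * x + b * y)) :
    ENNReal.ofReal a * (∫⁻ x, ENNReal.ofReal (f x)) + ENNReal.ofReal b * (∫⁻ x, ENNReal.ofReal (g x))
      ≤ ∫⁻ x, ENNReal.ofReal (h x) := by
  -- Layer-cake formula. The common supremum `1` makes the superlevel sets of `f` and `g` nonempty
  -- for exactly the same levels, as Brunn–Minkowski requires.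
  rw [lintegral_eq_lintegral_meas_lt _ (.of_forall hf0) hf.aemeasurable,
    lintegral_eq_lintegral_meas_lt _ (.of_forall hg0) hg.aemeasurable,
    lintegral_eq_lintegral_meas_lt _ (.of_forall hh0) hh.aemeasurable]
  have m1 : ∀ f : ℝ → ℝ, Measurable fun t => volume {x | t < f x} := fun f =>
    Antitone.measurable fun s t hst => measure_mono fun x (hx : t < f x) => lt_of_le_of_lt hst hx
  rw [← lintegral_const_mul _ (m1 f), ← lintegral_const_mul _ (m1 g),
    ← lintegral_add_left ((m1 f).const_mul _)]
  refine setLIntegral_mono (m1 h) fun t ht => ?_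
  rcases lt_or_ge t 1 with h1 | h1
  · exact brunnMinkowski_real (measurableSet_lt measurable_const hf)
      (measurableSet_lt measurable_const hg) (hfs t h1) (hgs t h1) ha hb
      fun x hx y hy => H x y t ht hx hy
  · have e1 : {x | t < f x} = ∅ := by
      ext x; simpa using (hf1 x).trans h1
    have e2 : {x | t < g x} = ∅ := by
      ext x; simpa using (hg1 x).trans h1
    simp [e1, e2]

/-- Dividing by the suprema yields the additive inequality of `prekopaLeindler_normalized`; weighted
AM–GM turns it into the multiplicative one, which is homogeneous and so undoes the scaling. -/
theorem prekopaLeindler_bounded {f g h : ℝ → ℝ≥0∞} (hf : Measurable f) (hg : Measurable g)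
    (hh : Measurable h) (hfb : ⨆ x, f x ≠ ⊤) (hgb : ⨆ x, g x ≠ ⊤)
    {a b : ℝ} (ha : 0 < a) (hb : 0 < b) (hab : a + b = 1)
    (H : ∀ x y, f x ^ a * g y ^ b ≤ h (a * x + b * y)) :
    (∫⁻ x, f x) ^ a * (∫⁻ x, g x) ^ b ≤ ∫⁻ x, h x := by
  set α := ⨆ x, f x with hα
  set β := ⨆ x, g x with hβ
  rcases eq_or_ne α 0 with h0 | hα0
  · have : ∀ x, f x = 0 := by simpa [hα] using h0
    simp [this, ha]
  rcases eq_or_ne β 0 with h0 | hβ0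
  · have : ∀ x, g x = 0 := by simpa [hβ] using h0
    simp [this, hb]
  set γ := α ^ a * β ^ b with hγ
  have hγ0 : γ ≠ 0 := by simp [hγ, hα0, hβ0, hfb, hgb]
  have hγt : γ ≠ ⊤ := ENNReal.mul_ne_top (ENNReal.rpow_ne_top_of_nonneg ha.le hfb)
    (ENNReal.rpow_ne_top_of_nonneg hb.le hgb)
  have key : ∀ f : ℝ → ℝ≥0∞, (⨆ x, f x) ≠ 0 → (⨆ x, f x) ≠ ⊤ →
      (∀ x, f x / (⨆ x, f x) ≤ 1) ∧ ∀ t < 1, ∃ x, t < (f x / (⨆ x, f x)).toReal := by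
    intro f h0 ht
    have h1 : ∀ x, f x / (⨆ x, f x) ≤ 1 := fun x => ENNReal.div_le_of_le_mul (by
      simpa using le_iSup f x)
    refine ⟨h1, fun t ht1 => ?_⟩
    rcases lt_or_ge t 0 with h | h
    · exact ⟨0, h.trans_le ENNReal.toReal_nonneg⟩
    have : ENNReal.ofReal t * (⨆ x, f x) < ⨆ x, f x := by
      conv_rhs => rw [← one_mul (⨆ x, f x)]
      exact ENNReal.mul_lt_mul_left h0 ht (by simpa using ht1)
    obtain ⟨x, hx⟩ := lt_iSup_iff.1 this
    refine ⟨x, ?_⟩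
    rw [← ENNReal.ofReal_lt_iff_lt_toReal h (ne_top_of_le_ne_top ENNReal.one_ne_top (h1 x))]
    exact (ENNReal.lt_div_iff_mul_lt (.inl h0) (.inl ht)).2 hx
  obtain ⟨(hf1 : ∀ x, f x / α ≤ 1), hf2⟩ := key f hα0 hfb
  obtain ⟨(hg1 : ∀ x, g x / β ≤ 1), hg2⟩ := key g hβ0 hgb
  have hfin : ∀ {z : ℝ≥0∞}, z ≤ 1 → z ≠ ⊤ := fun hz => ne_top_of_le_ne_top ENNReal.one_ne_top hz
  -- Cutting `h / γ` off at `1` makes it real-valued and loses nothing, since only levels below `1`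
  -- matter.
  have main := prekopaLeindler_normalized (f := fun x => (f x / α).toReal)
    (g := fun x => (g x / β).toReal) (h := fun x => (min (h x / γ) 1).toReal)
    (by fun_prop) (by fun_prop) (by fun_prop) (fun _ => ENNReal.toReal_nonneg)
    (fun _ => ENNReal.toReal_nonneg) (fun _ => ENNReal.toReal_nonneg)
    (fun x => ENNReal.toReal_le_of_le_ofReal zero_le_one (by simpa using hf1 x))
    (fun x => ENNReal.toReal_le_of_le_ofReal zero_le_one (by simpa using hg1 x))
    hf2 hg2 ha hb ?_
  · simp only [ENNReal.ofReal_toReal (hfin (hf1 _)), ENNReal.ofReal_toReal (hfin (hg1 _)),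
      ENNReal.ofReal_toReal (hfin (min_le_right _ _))] at main
    have h3 : ∫⁻ x, min (h x / γ) 1 ≤ (∫⁻ x, h x) / γ := by
      rw [div_eq_mul_inv, ← lintegral_mul_const _ hh]
      exact lintegral_mono fun x => (min_le_left _ _).trans_eq (div_eq_mul_inv _ _)
    have h4 := (ENNReal.rpow_mul_rpow_le_add ha hb hab _ _).trans (main.trans h3)
    simp only [div_eq_mul_inv] at h4
    rw [lintegral_mul_const _ hf, lintegral_mul_const _ hg, ← div_eq_mul_inv, ← div_eq_mul_inv,
      ENNReal.div_rpow_of_nonneg _ _ ha.le, ENNReal.div_rpow_of_nonneg _ _ hb.le,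
      ← div_eq_mul_inv, ENNReal.le_div_iff_mul_le (.inl hγ0) (.inl hγt)] at h4
    refine le_trans (le_of_eq ?_) h4
    have e1 : α ^ a ≠ 0 := by simp [hα0, hfb]
    have e2 : β ^ b ≠ 0 := by simp [hβ0, hgb]
    rw [hγ, mul_mul_mul_comm, ENNReal.div_mul_cancel e1 (ENNReal.rpow_ne_top_of_nonneg ha.le hfb),
      ENNReal.div_mul_cancel e2 (ENNReal.rpow_ne_top_of_nonneg hb.le hgb)]
  · intro x y t ht hx hy
    have ht1 : t < 1 := hx.trans_le
      (ENNReal.toReal_le_of_le_ofReal zero_le_one (by simpa using hf1 x))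
    rw [← ENNReal.ofReal_lt_iff_lt_toReal ht.le (hfin (hf1 _)),
      ENNReal.lt_div_iff_mul_lt (.inl hα0) (.inl hfb)] at hx
    rw [← ENNReal.ofReal_lt_iff_lt_toReal ht.le (hfin (hg1 _)),
      ENNReal.lt_div_iff_mul_lt (.inl hβ0) (.inl hgb)] at hy
    rw [← ENNReal.ofReal_lt_iff_lt_toReal ht.le (hfin (min_le_right _ _)), lt_min_iff,
      ENNReal.lt_div_iff_mul_lt (.inl hγ0) (.inl hγt)]
    refine ⟨lt_of_lt_of_le ?_ (H x y), by simpa using ht1⟩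
    refine lt_of_eq_of_lt ?_ (ENNReal.mul_lt_mul (ENNReal.rpow_lt_rpow hx ha)
      (ENNReal.rpow_lt_rpow hy hb))
    rw [ENNReal.mul_rpow_of_nonneg _ _ ha.le, ENNReal.mul_rpow_of_nonneg _ _ hb.le,
      mul_mul_mul_comm, ← ENNReal.rpow_add_of_nonneg _ _ ha.le hb.le, hab, ENNReal.rpow_one]

/-- The Prékopa–Leindler inequality on the real line. -/
theorem prekopaLeindler_real {f g h : ℝ → ℝ≥0∞} (hf : Measurable f) (hg : Measurable g)
    (hh : Measurable h) {a b : ℝ} (ha : 0 < a) (hb : 0 < b) (hab : a + b = 1)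
    (H : ∀ x y, f x ^ a * g y ^ b ≤ h (a * x + b * y)) :
    (∫⁻ x, f x) ^ a * (∫⁻ x, g x) ^ b ≤ ∫⁻ x, h x := by
  rcases eq_or_ne (∫⁻ x, f x) 0 with h0 | hf0
  · simp [h0, ha]
  rcases eq_or_ne (∫⁻ x, g x) 0 with h0 | hg0
  · simp [h0, hb]
  have bd : ∀ (f : ℝ → ℝ≥0∞) (N : ℕ), ⨆ x, min (f x) N ≠ ⊤ := fun f N =>
    ne_top_of_le_ne_top (ENNReal.natCast_ne_top N) (iSup_le fun _ => min_le_right _ _)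
  have lim : ∀ f : ℝ → ℝ≥0∞, Measurable f → Filter.Tendsto (fun N : ℕ => ∫⁻ x, min (f x) N)
      Filter.atTop (𝓝 (∫⁻ x, f x)) := by
    intro f hf
    refine lintegral_tendsto_of_tendsto_of_monotone (fun N => by fun_prop)
      (.of_forall fun x N M hNM => min_le_min_left _ (by exact_mod_cast hNM))
      (.of_forall fun x => ?_)
    simpa using (tendsto_const_nhds (x := f x)).min ENNReal.tendsto_nat_nhds_top
  -- Truncate `f` and `g` at height `N` and pass to the limit by monotone convergence.
  refine le_of_tendsto (ENNReal.Tendsto.mul (((lim f hf).ennrpow_const a))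
    (.inl (by simp [hf0, ha.le])) ((lim g hg).ennrpow_const b)
    (.inl (by simp [hg0, hb.le]))) (.of_forall fun N => ?_)
  exact prekopaLeindler_bounded (by fun_prop) (by fun_prop) hh (bd f N) (bd g N) ha hb hab
    fun x y => le_trans (by gcongr <;> exact min_le_left _ _) (H x y)

/-- The Prékopa–Leindler inequality. -/
theorem prekopaLeindler_pi {m : ℕ} {f g h : (Fin m → ℝ) → ℝ≥0∞} (hf : Measurable f)
    (hg : Measurable g) (hh : Measurable h) {a b : ℝ} (ha : 0 < a) (hb : 0 < b) (hab : a + b = 1)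
    (H : ∀ x y, f x ^ a * g y ^ b ≤ h (a • x + b • y)) :
    (∫⁻ x, f x) ^ a * (∫⁻ x, g x) ^ b ≤ ∫⁻ x, h x := by
  induction m with
  | zero =>
    simp only [lintegral_unique, volume_pi, mul_one, Measure.pi_empty_univ]
    convert H default default
  | succ m ih =>
    have e := (volume_preserving_piFinSuccAbove (fun _ : Fin (m + 1) => ℝ) 0).symm
    set φ := (MeasurableEquiv.piFinSuccAbove (fun _ : Fin (m + 1) => ℝ) 0).symm with hφ
    have hadd : ∀ s t y z, φ (a * s + b * t, a • y + b • z) = a • φ (s, y) + b • φ (t, z) := by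
      intro s t y z
      ext i
      refine Fin.cases ?_ (fun j => ?_) i <;> simp [hφ]
    have key : ∀ f : (Fin (m + 1) → ℝ) → ℝ≥0∞, Measurable f →
        ∫⁻ x, f x = ∫⁻ s, ∫⁻ y, f (φ (s, y)) := by
      intro f hf
      rw [← e.lintegral_comp hf, Measure.volume_eq_prod, lintegral_prod _ (by fun_prop)]
    rw [key f hf, key g hg, key h hh]
    have meas : ∀ f : (Fin (m + 1) → ℝ) → ℝ≥0∞, Measurable f →
        Measurable fun s => ∫⁻ y, f (φ (s, y)) := fun f hf =>
      Measurable.lintegral_prod_right' (f := fun p => f (φ p)) (by fun_prop)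
    -- Induction on dimension: the inequality in `m` variables is the hypothesis needed for the
    -- one-dimensional inequality of the partial integrals.
    refine prekopaLeindler_real (meas f hf) (meas g hg) (meas h hh) ha hb hab fun s t => ?_
    refine ih (by fun_prop) (by fun_prop) (by fun_prop) fun y z => ?_
    rw [hadd]
    exact H _ _

/-! ### Log-concave functions on the line: slopes, tails and midpoint gains. -/

/-- Nonnegative log-concave functions on the real line. -/
structure IsLogConcave (F : ℝ → ℝ) : Prop where
  nonneg : ∀ x, 0 ≤ F x
  rpow_mul_le : ∀ x y a b : ℝ, 0 < a → 0 < b → a + b = 1 → F x ^ a * F y ^ b ≤ F (a * x + b * y)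

namespace IsLogConcave

variable {F : ℝ → ℝ}

theorem comp_neg (hF : IsLogConcave F) : IsLogConcave fun x => F (-x) where
  nonneg x := hF.nonneg _
  rpow_mul_le x y a b ha hb hab := by
    refine (hF.rpow_mul_le (-x) (-y) a b ha hb hab).trans_eq ?_
    congr 1; ring

theorem min_le (hF : IsLogConcave F) {x y z : ℝ} (hxz : x ≤ z) (hzy : z ≤ y) :
    min (F x) (F y) ≤ F z := by
  rcases hxz.eq_or_lt with rfl | hxz
  · exact min_le_left _ _
  rcases hzy.eq_or_lt with rfl | hzy
  · exact min_le_right _ _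
  have hd : 0 < y - x := by linarith
  have h := hF.rpow_mul_le x y ((y - z) / (y - x)) ((z - x) / (y - x))
    (div_pos (by linarith) hd) (div_pos (by linarith) hd) (by field_simp; ring)
  have e : (y - z) / (y - x) * x + (z - x) / (y - x) * y = z := by field_simp; ring
  rw [e] at h
  refine le_trans ?_ h
  have hm : 0 ≤ min (F x) (F y) := le_min (hF.nonneg _) (hF.nonneg _)
  calc min (F x) (F y) = min (F x) (F y) ^ ((y - z) / (y - x)) *
        min (F x) (F y) ^ ((z - x) / (y - x)) := by
        rw [← Real.rpow_add_of_nonneg hm (div_nonneg (by linarith) hd.le)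
          (div_nonneg (by linarith) hd.le)]
        rw [← add_div, show y - z + (z - x) = y - x by ring, div_self hd.ne', Real.rpow_one]
    _ ≤ _ := by
        have h1 : 0 ≤ (y - z) / (y - x) := div_nonneg (by linarith) hd.le
        have h2 : 0 ≤ (z - x) / (y - x) := div_nonneg (by linarith) hd.le
        gcongr
        · exact Real.rpow_nonneg (hF.nonneg _) _
        · exact min_le_left _ _
        · exact min_le_right _ _

/-- A log-concave function decays at least as fast as the exponential given by any
preceding slope of its logarithm. -/
theorem le_mul_exp (hF : IsLogConcave F) {x ε r : ℝ} (hε : 0 < ε) (hr : 0 ≤ r) (hx : 0 < F x)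
    (hxε : 0 < F (x - ε)) :
    F (x + r) ≤ F x * Real.exp (-((Real.log (F (x - ε)) - Real.log (F x)) / ε * r)) := by
  rcases hr.eq_or_lt with rfl | hr
  · simp
  rcases (hF.nonneg (x + r)).eq_or_lt with h0 | h0
  · rw [← h0]; positivity
  have hd : 0 < r + ε := by linarith
  have h := hF.rpow_mul_le (x - ε) (x + r) (r / (r + ε)) (ε / (r + ε))
    (by positivity) (by positivity) (by field_simp)
  have e : r / (r + ε) * (x - ε) + ε / (r + ε) * (x + r) = x := by field_simp; ring
  rw [e] at h
  have h2 := Real.log_le_log (by positivity) h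
  rw [Real.log_mul (by positivity) (by positivity), Real.log_rpow hxε, Real.log_rpow h0] at h2
  rw [← Real.log_le_log_iff h0 (by positivity), Real.log_mul hx.ne' (Real.exp_pos _).ne',
    Real.log_exp]
  have h3 : r * Real.log (F (x - ε)) + ε * Real.log (F (x + r)) ≤ (r + ε) * Real.log (F x) := by
    field_simp at h2
    linarith
  have h4 : Real.log (F (x + r)) ≤ ((r + ε) * Real.log (F x) - r * Real.log (F (x - ε))) / ε := by
    rw [le_div_iff₀ hε]; linarith
  refine h4.trans_eq ?_
  field_simp
  ring

/-- If `log F` descends at rate `k > 0` just before `x`, then `F` is dominated after `x` by `F x`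
times an exponential of rate `k`, whose integral is `F x / k`. -/
theorem slope_mul_integral_Ioi_le (hF : IsLogConcave F) (hint : Integrable F) {x ε : ℝ}
    (hε : 0 < ε) (hx : 0 < F x) (hxε : 0 < F (x - ε)) :
    (Real.log (F (x - ε)) - Real.log (F x)) / ε * ∫ s in Set.Ioi x, F s ≤ F x := by
  set k := (Real.log (F (x - ε)) - Real.log (F x)) / ε with hk
  rcases le_or_gt k 0 with h | h
  · have : 0 ≤ ∫ s in Set.Ioi x, F s := integral_nonneg hF.nonneg
    nlinarith
  have h1 : ∫ s in Set.Ioi x, F s ≤ ∫ s in Set.Ioi x, F x * Real.exp (k * x) * Real.exp (-k * s) := by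
    refine setIntegral_mono_on hint.integrableOn
      ((integrableOn_exp_mul_Ioi (by linarith) x).const_mul _) measurableSet_Ioi fun s hs => ?_
    have := hF.le_mul_exp hε (sub_nonneg.2 (le_of_lt hs)) hx hxε
    rw [add_sub_cancel, ← hk] at this
    refine this.trans_eq ?_
    rw [mul_assoc, ← Real.exp_add]
    congr 2; ring
  rw [integral_const_mul, integral_exp_mul_Ioi (by linarith)] at h1
  have h2 : k * (F x * Real.exp (k * x) * (-Real.exp (-k * x) / -k)) = F x := by
    rw [neg_div_neg_eq]
    field_simp
    rw [← Real.exp_add]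
    simp
  calc _ ≤ _ := mul_le_mul_of_nonneg_left h1 h.le
    _ = _ := h2

end IsLogConcave

theorem exists_integral_Ioi_eq {F : ℝ → ℝ} (hint : Integrable F) {τ : ℝ} (h0 : 0 < τ)
    (h1 : τ < ∫ s, F s) : ∃ b, ∫ s in Set.Ioi b, F s = τ := by
  have hc : Continuous fun b => ∫ s in Set.Ioi b, F s := by
    have : (fun b => ∫ s in Set.Ioi b, F s)
        = fun b => (∫ s in Set.Ioi 0, F s) - ∫ s in (0 : ℝ)..b, F s := by
      ext b
      rw [← intervalIntegral.integral_Ioi_sub_Ioi' hint.integrableOn hint.integrableOn]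
      ring
    rw [this]
    exact continuous_const.sub
      (intervalIntegral.continuous_primitive (fun _ _ => hint.intervalIntegrable) 0)
  have t1 : Filter.Tendsto (fun b => ∫ s in Set.Ioi b, F s) Filter.atTop (𝓝 0) := by
    have := intervalIntegral_tendsto_integral_Ioi 0 hint.integrableOn Filter.tendsto_id
    have h2 := (tendsto_const_nhds (x := ∫ s in Set.Ioi 0, F s)).sub this
    rw [sub_self] at h2
    refine h2.congr fun b => ?_
    rw [← intervalIntegral.integral_Ioi_sub_Ioi' hint.integrableOn hint.integrableOn, id]
    ring
  have t2 : Filter.Tendsto (fun b => ∫ s in Set.Ioi b, F s) Filter.atBot (𝓝 (∫ s, F s)) := by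
    have := intervalIntegral_tendsto_integral_Iic 0 hint.integrableOn Filter.tendsto_id
    have h2 := (tendsto_const_nhds (x := ∫ s in Set.Ioi 0, F s)).add this
    rw [add_comm, intervalIntegral.integral_Iic_add_Ioi hint.integrableOn hint.integrableOn] at h2
    refine h2.congr fun b => ?_
    rw [← intervalIntegral.integral_Ioi_sub_Ioi' hint.integrableOn hint.integrableOn, id]
    ring
  obtain ⟨x, hx⟩ := (t1.eventually (gt_mem_nhds h0)).exists
  obtain ⟨y, hy⟩ := (t2.eventually (lt_mem_nhds h1)).exists
  exact mem_range_of_exists_le_of_exists_ge hc ⟨x, hx.le⟩ ⟨y, hy.le⟩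

/-- If the logarithm of a log-concave function `F ≤ M` satisfies an improved midpoint concavity
inequality with gain `κ ε ^ 2` on a portion of mass `p`, then `κ p ^ 2 ≤ 32 M ^ 2`. -/
theorem IsLogConcave.mul_sq_le_of_midpoint_gain {F q : ℝ → ℝ} (hF : IsLogConcave F)
    (hFm : Measurable F) (hint : Integrable F) {M : ℝ} (hM0 : 0 < M) (hM : ∀ x, F x ≤ M)
    (hqm : Measurable q) (hq0 : ∀ x, 0 ≤ q x) (hqF : ∀ x, q x ≤ F x) {p : ℝ} (hp : 0 < p)
    (hpq : p ≤ ∫ s, q s) {κ ε₀ : ℝ} (hκ : 0 < κ) (hε₀ : 0 < ε₀)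
    (H : ∀ ε, 0 < ε → ε ≤ ε₀ → ∀ s,
      √(F (s - ε) * F (s + ε)) ≤ F s - (1 - Real.exp (-(κ * ε ^ 2))) * q s) :
    κ * p ^ 2 ≤ 32 * M ^ 2 := by
  have hqint : Integrable q := hint.mono' hqm.aestronglyMeasurable
    (.of_forall fun x => by rw [Real.norm_of_nonneg (hq0 x)]; exact hqF x)
  have hpF : p ≤ ∫ s, F s := hpq.trans (integral_mono hqint hint hqF)
  -- Both tails of `F` have mass `p / 4`; as `q ≤ F`, at least `p / 2` of the mass of `q` remains in
  -- `[a, b]`.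
  obtain ⟨b, hb⟩ := exists_integral_Ioi_eq hint (τ := p / 4) (by linarith) (by linarith)
  obtain ⟨a', ha'⟩ := exists_integral_Ioi_eq hint.comp_neg (τ := p / 4) (by linarith)
    (by rw [integral_neg_eq_self]; linarith)
  obtain ⟨a, rfl⟩ : ∃ a, a' = -a := ⟨-a', by ring⟩
  have ha := ha'
  rw [integral_comp_neg_Ioi, neg_neg] at ha
  have hqle : ∀ s : Set ℝ, ∫ x in s, q x ≤ ∫ x in s, F x := fun s =>
    integral_mono hqint.integrableOn hint.integrableOn hqF
  have hqab : p / 2 ≤ ∫ s in a..b, q s := by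
    have e1 := intervalIntegral.integral_Iic_sub_Iic (hqint.integrableOn (s := Set.Iic a))
      (hqint.integrableOn (s := Set.Iic b))
    have e2 := intervalIntegral.integral_Iic_add_Ioi (hqint.integrableOn (s := Set.Iic b))
      (hqint.integrableOn (s := Set.Ioi b))
    have := hqle (Set.Iic a)
    have := hqle (Set.Ioi b)
    linarith
  have hab : a < b := by
    by_contra! h
    rw [intervalIntegral.integral_symm] at hqab
    have := intervalIntegral.integral_nonneg (μ := volume) h fun x _ => hq0 x
    linarith
  have hpos : ∀ s, a ≤ s → s ≤ b → 0 < F s := by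
    have hb' : ∃ y, b < y ∧ 0 < F y := by
      by_contra! h
      have : ∫ s in Set.Ioi b, F s ≤ 0 := setIntegral_nonpos measurableSet_Ioi fun x hx => h x hx
      linarith
    have ha' : ∃ y, y ≤ a ∧ 0 < F y := by
      by_contra! h
      have : ∫ s in Set.Iic a, F s ≤ 0 := setIntegral_nonpos measurableSet_Iic fun x hx => h x hx
      linarith
    obtain ⟨y, hy, hy0⟩ := hb'
    obtain ⟨x, hx, hx0⟩ := ha'
    intro s hs1 hs2
    exact (lt_min hx0 hy0).trans_le (hF.min_le (hx.trans hs1) (hs2.trans hy.le))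
  set m := min (F a) (F b) with hm
  have hm0 : 0 < m := lt_min (hpos a le_rfl hab.le) (hpos b hab.le le_rfl)
  -- The cutoff at `m` makes `ℓ` bounded, hence interval integrable everywhere, and leaves `log F`
  -- unchanged on `[a, b]`.
  set ℓ : ℝ → ℝ := fun s => Real.log (max (F s) m) with hℓ
  have hℓF : ∀ s, a ≤ s → s ≤ b → ℓ s = Real.log (F s) := fun s h1 h2 => by
    simp only [hℓ]
    rw [max_eq_left (hF.min_le h1 h2)]
  have hℓm : Measurable ℓ := by fun_prop
  have hℓi : ∀ x y, IntervalIntegrable ℓ volume x y := fun x y => by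
    refine (intervalIntegrable_const (c := |Real.log m| + |Real.log (max M m)|)).mono_fun
      hℓm.aestronglyMeasurable (.of_forall fun s => ?_)
    have h1 : Real.log m ≤ ℓ s := Real.log_le_log hm0 (le_max_right _ _)
    have h2 : ℓ s ≤ Real.log (max M m) :=
      Real.log_le_log (lt_max_of_lt_right hm0) (max_le_max_right _ (hM s))
    simp only [Real.norm_eq_abs]
    rw [abs_of_nonneg (by positivity : 0 ≤ |Real.log m| + |Real.log (max M m)|), abs_le]
    constructor
    · have := neg_abs_le (Real.log m); have := abs_nonneg (Real.log (max M m)); linarith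
    · have := le_abs_self (Real.log (max M m)); have := abs_nonneg (Real.log m); linarith
  -- These bounds give, in turn, `1 - exp (-κ ε²) ≥ κ ε² / 2`, a loss of at most `p / 4` on trimming
  -- `ε` from both ends of `[a, b]`, and a nonempty trimmed interval.
  obtain ⟨ε, hε0, hεε₀, hε1, hε2, hε3⟩ : ∃ ε > 0, ε ≤ ε₀ ∧ κ * ε ^ 2 ≤ 1 ∧ 2 * M * ε ≤ p / 4 ∧
      2 * ε ≤ b - a := by
    have t : ∀ᶠ ε : ℝ in 𝓝[>] 0, κ * ε ^ 2 < 1 ∧ 2 * M * ε < p / 4 ∧ 2 * ε < b - a ∧ ε < ε₀ := by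
      refine Filter.Eventually.filter_mono nhdsWithin_le_nhds ?_
      refine .and ?_ (.and ?_ (.and ?_ ?_)) <;>
      refine ContinuousAt.eventually_lt (by fun_prop) (by fun_prop) ?_ <;> simp [hp, hab, hε₀]
    obtain ⟨ε, ⟨h1, h2, h3, h4⟩, h5⟩ := (t.and self_mem_nhdsWithin).exists
    exact ⟨ε, h5, h4.le, h1.le, h2.le, h3.le⟩
  set c := 1 - Real.exp (-(κ * ε ^ 2)) with hc
  have hcκ : κ * ε ^ 2 / 2 ≤ c := by
    have h0 : 0 < κ * ε ^ 2 := by positivity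
    have h1 := Real.add_one_le_exp (κ * ε ^ 2)
    have h2 : Real.exp (-(κ * ε ^ 2)) ≤ 1 - κ * ε ^ 2 / 2 := by
      rw [Real.exp_neg]
      refine inv_le_of_inv_le₀ (by linarith) (le_trans ?_ h1)
      rw [inv_le_iff_one_le_mul₀ (by linarith)]
      nlinarith
    linarith
  have hc0 : 0 ≤ c := le_trans (by positivity) hcκ
  -- Discrete form of `q / M ≲ -(log F)''`: take logarithms, use `log (1 - x) ≤ -x`, and bound `F s`
  -- by `M`.
  have hpt : ∀ s ∈ Set.Icc (a + ε) (b - ε),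
      c * q s ≤ M / 2 * (2 * ℓ s - ℓ (s + ε) - ℓ (s - ε)) := by
    intro s hs
    obtain ⟨h1, h2⟩ := hs
    have f0 := hpos s (by linarith) (by linarith)
    have f1 := hpos (s - ε) (by linarith) (by linarith)
    have f2 := hpos (s + ε) (by linarith) (by linarith)
    rw [hℓF s (by linarith) (by linarith), hℓF (s - ε) (by linarith) (by linarith),
      hℓF (s + ε) (by linarith) (by linarith)]
    have h := H ε hε0 hεε₀ s
    rw [← hc] at h
    have hpos' : 0 < F s - c * q s := lt_of_lt_of_le (by positivity) h
    have hl := Real.log_le_log (by positivity) h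
    rw [Real.log_sqrt (by positivity), Real.log_mul f1.ne' f2.ne'] at hl
    have h3 : Real.log (F s - c * q s) ≤ Real.log (F s) - c * q s / F s := by
      have := Real.log_le_sub_one_of_pos (div_pos hpos' f0)
      rw [Real.log_div hpos'.ne' f0.ne', sub_div, div_self f0.ne'] at this
      linarith
    have h4 : c * q s / F s ≤ (2 * Real.log (F s) - Real.log (F (s + ε)) - Real.log (F (s - ε))) / 2 := by
      linarith
    have h5 : 0 ≤ c * q s / F s := div_nonneg (mul_nonneg hc0 (hq0 s)) f0.le
    calc c * q s = F s * (c * q s / F s) := by field_simp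
      _ ≤ M * ((2 * Real.log (F s) - Real.log (F (s + ε)) - Real.log (F (s - ε))) / 2) :=
        mul_le_mul (hM s) h4 h5 hM0.le
      _ = _ := by ring
  have hI : c * (p / 4) ≤ M / 2 * ∫ s in (a + ε)..(b - ε), (2 * ℓ s - ℓ (s + ε) - ℓ (s - ε)) := by
    have hq1 : ∀ x, ∫ s in x..(x + ε), q s ≤ M * ε := fun x => by
      have := intervalIntegral.integral_mono_on (μ := volume) (f := q) (g := fun _ => M)
        (show x ≤ x + ε by linarith) hqint.intervalIntegrable intervalIntegrable_const
        fun s _ => (hqF s).trans (hM s)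
      simpa [mul_comm] using this
    have e1 := intervalIntegral.integral_add_adjacent_intervals (hqint.intervalIntegrable (a := a) (b := a + ε))
      (hqint.intervalIntegrable (b := b - ε))
    have e2 := intervalIntegral.integral_add_adjacent_intervals (hqint.intervalIntegrable (a := a) (b := b - ε))
      (hqint.intervalIntegrable (b := b))
    have h1 := hq1 a
    have h2 := hq1 (b - ε)
    rw [sub_add_cancel] at h2
    calc c * (p / 4) ≤ c * ∫ s in (a + ε)..(b - ε), q s := by gcongr; linarith
      _ = ∫ s in (a + ε)..(b - ε), c * q s := by simp
      _ ≤ ∫ s in (a + ε)..(b - ε), M / 2 * (2 * ℓ s - ℓ (s + ε) - ℓ (s - ε)) := by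
        refine intervalIntegral.integral_mono_on (by linarith)
          (hqint.intervalIntegrable.const_mul _) ?_ hpt
        refine IntervalIntegrable.const_mul (((hℓi _ _).const_mul _).sub ?_ |>.sub ?_) _
        · simpa using (hℓi (a + ε + ε) (b - ε + ε)).comp_add_right ε
        · simpa using (hℓi (a + ε - ε) (b - ε - ε)).comp_sub_right ε
      _ = _ := by simp
  have hℓadd : ∀ x y, IntervalIntegrable (fun s => ℓ (s + ε)) volume x y := fun x y => by
    simpa using (hℓi (x + ε) (y + ε)).comp_add_right ε
  have hℓsub : ∀ x y, IntervalIntegrable (fun s => ℓ (s - ε)) volume x y := fun x y => by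
    simpa using (hℓi (x - ε) (y - ε)).comp_sub_right ε
  -- The integral of second differences telescopes to first differences on two boundary layers of
  -- width `ε`.
  have htel : ∫ s in (a + ε)..(b - ε), (2 * ℓ s - ℓ (s + ε) - ℓ (s - ε)) =
      (∫ s in (b - ε)..b, (ℓ (s - ε) - ℓ s)) + ∫ s in a..(a + ε), (ℓ (s + ε) - ℓ s) := by
    rw [intervalIntegral.integral_sub (((hℓi _ _).const_mul _).sub (hℓadd _ _)) (hℓsub _ _),
      intervalIntegral.integral_sub ((hℓi _ _).const_mul _) (hℓadd _ _),
      intervalIntegral.integral_sub (hℓsub _ _) (hℓi _ _),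
      intervalIntegral.integral_sub (hℓadd _ _) (hℓi _ _),
      intervalIntegral.integral_const_mul]
    simp only [intervalIntegral.integral_comp_add_right, intervalIntegral.integral_comp_sub_right]
    have Φ : ∀ x y, ∫ s in x..y, ℓ s = (∫ s in (0 : ℝ)..y, ℓ s) - ∫ s in (0 : ℝ)..x, ℓ s :=
      fun x y => (intervalIntegral.integral_interval_sub_left (hℓi _ _) (hℓi _ _)).symm
    rw [Φ (a + ε) (b - ε), Φ (a + ε + ε), Φ (a + ε - ε), Φ (b - ε - ε), Φ (b - ε) b, Φ (a + ε) (a + ε + ε),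
      Φ a]
    simp only [sub_add_cancel, add_sub_cancel_right]
    ring
  -- The tail beyond `s` has mass at least `p / 4`, so the slope is at most `M / (p / 4)`. This
  -- serves the right end with `F` and the left end with its reflection.
  have hslope : ∀ (G : ℝ → ℝ), IsLogConcave G → Integrable G → (∀ x, G x ≤ M) → ∀ s b, s ≤ b →
      ∫ s in Set.Ioi b, G s = p / 4 → 0 < G s → 0 < G (s - ε) →
      Real.log (G (s - ε)) - Real.log (G s) ≤ 4 * M / p * ε := by
    intro G hG hGi hGM s b hsb hGb h1 h2
    have := hG.slope_mul_integral_Ioi_le hGi hε0 h1 h2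
    have h3 : p / 4 ≤ ∫ s in Set.Ioi s, G s := by
      rw [← hGb]
      exact setIntegral_mono_set hGi.integrableOn (.of_forall hG.nonneg)
        (Set.Ioi_subset_Ioi hsb).eventuallyLE
    by_contra! h
    rw [← lt_div_iff₀ hε0] at h
    have h5 : 0 < 4 * M / p := by positivity
    have h6 : 4 * M / p * (p / 4) = M := by field_simp
    have := hGM s
    nlinarith
  have hr : ∫ s in (b - ε)..b, (ℓ (s - ε) - ℓ s) ≤ 4 * M / p * ε * ε := by
    have := intervalIntegral.integral_mono_on (μ := volume) (g := fun _ => 4 * M / p * ε)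
      (show b - ε ≤ b by linarith) ((hℓsub (b - ε) b).sub (hℓi _ _)) intervalIntegrable_const
      fun s hs => by
        have h1 := hs.1
        have h2 := hs.2
        rw [hℓF s (by linarith) (by linarith), hℓF (s - ε) (by linarith) (by linarith)]
        exact hslope F hF hint hM s b h2 hb (hpos _ (by linarith) (by linarith))
          (hpos _ (by linarith) (by linarith))
    refine this.trans_eq ?_
    rw [intervalIntegral.integral_const, smul_eq_mul]
    ring
  have hl : ∫ s in a..(a + ε), (ℓ (s + ε) - ℓ s) ≤ 4 * M / p * ε * ε := by
    have := intervalIntegral.integral_mono_on (μ := volume) (g := fun _ => 4 * M / p * ε)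
      (show a ≤ a + ε by linarith) ((hℓadd a (a + ε)).sub (hℓi _ _)) intervalIntegrable_const
      fun s hs => by
        have h1 := hs.1
        have h2 := hs.2
        rw [hℓF s (by linarith) (by linarith), hℓF (s + ε) (by linarith) (by linarith)]
        have := hslope (fun x => F (-x)) hF.comp_neg hint.comp_neg (fun x => hM _) (-s) (-a)
          (by linarith) ha' (by simpa using hpos _ (by linarith) (by linarith))
          (by simpa [add_comm] using hpos (s + ε) (by linarith) (by linarith))
        simpa [add_comm] using this
    refine this.trans_eq ?_
    rw [intervalIntegral.integral_const, smul_eq_mul]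
    ring
  rw [htel] at hI
  have h1 : κ * ε ^ 2 / 2 * (p / 4) ≤ M / 2 * (4 * M / p * ε * ε + 4 * M / p * ε * ε) :=
    le_trans (by gcongr) (hI.trans (by gcongr))
  have h2 : M / 2 * (4 * M / p * ε * ε + 4 * M / p * ε * ε) = ε ^ 2 * (4 * M ^ 2 / p) := by ring
  rw [h2] at h1
  have h3 : κ / 8 * p ≤ 4 * M ^ 2 / p := by
    have : 0 < ε ^ 2 := by positivity
    nlinarith
  rw [le_div_iff₀ hp] at h3
  linarith

/-! ### Boundedness and second moments of log-concave densities. -/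

theorem lintegral_comp_half_mul_add (F : ℝ → ℝ≥0∞) (hF : Measurable F) (s : ℝ) :
    ∫⁻ y, F (1 / 2 * y + 1 / 2 * s) = 2 * ∫⁻ y, F y := by
  have h1 : ∫⁻ y, F y = ∫⁻ y, F (y + 1 / 2 * s) := (lintegral_add_right_eq_self F _).symm
  have h2 : ∫⁻ y, F (y + 1 / 2 * s)
      = ENNReal.ofReal (1 / 2) * ∫⁻ y, F (1 / 2 * y + 1 / 2 * s) := by
    conv_lhs => rw [← Real.smul_map_volume_mul_left (a := 1 / 2) (by norm_num)]
    rw [lintegral_smul_measure, lintegral_map (by fun_prop) (by fun_prop), smul_eq_mul,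
      abs_of_pos (by norm_num)]
  rw [h1, h2, ← mul_assoc, show (2 : ℝ≥0∞) = ENNReal.ofReal 2 by simp,
    ← ENNReal.ofReal_mul (by norm_num)]
  norm_num

/-- A nonzero integrable log-concave function on the line is bounded. -/
theorem exists_bound_of_logConcave {F : ℝ → ℝ≥0∞} (hFm : Measurable F)
    (hF : ∀ x y a b : ℝ, 0 < a → 0 < b → a + b = 1 → F x ^ a * F y ^ b ≤ F (a * x + b * y))
    (h0 : ∫⁻ x, F x ≠ 0) (hi : ∫⁻ x, F x ≠ ⊤) : ⨆ x, F x ≠ ⊤ := by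
  set K := ∫⁻ x, F x ^ (1 / 2 : ℝ) with hK
  have hK0 : K ≠ 0 := by
    intro h
    rw [hK, lintegral_eq_zero_iff (by fun_prop)] at h
    apply h0
    rw [lintegral_eq_zero_iff hFm]
    filter_upwards [h] with x hx
    exact (ENNReal.rpow_eq_zero_iff_of_pos (by norm_num)).1 hx
  -- Integrate `√(F y) √(F s) ≤ F ((y + s) / 2)` over `y`.
  have key : ∀ s, K * F s ^ (1 / 2 : ℝ) ≤ 2 * ∫⁻ x, F x := fun s => by
    rw [hK, ← lintegral_comp_half_mul_add F hFm s, ← lintegral_mul_const _ (by fun_prop)]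
    exact lintegral_mono fun y => hF y s _ _ (by norm_num) (by norm_num) (by norm_num)
  have h2 : 2 * ∫⁻ x, F x ≠ ⊤ := ENNReal.mul_ne_top (by simp) hi
  refine ne_top_of_le_ne_top (b := ((2 * ∫⁻ x, F x) / K) ^ (2 : ℝ)) ?_ (iSup_le fun s => ?_)
  · exact ENNReal.rpow_ne_top_of_nonneg (by norm_num) (ENNReal.div_ne_top h2 hK0)
  · have h3 : F s ^ (1 / 2 : ℝ) ≤ (2 * ∫⁻ x, F x) / K := by
      rw [ENNReal.le_div_iff_mul_le (.inl hK0) (.inr h2), mul_comm]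
      exact key s
    calc F s = (F s ^ (1 / 2 : ℝ)) ^ (2 : ℝ) := by rw [← ENNReal.rpow_mul]; norm_num
      _ ≤ _ := ENNReal.rpow_le_rpow h3 (by norm_num)

/-- Within distance `8 / M` of `s₀` the function must fall to `M / 4`, since otherwise that interval
alone would carry mass `2`. So `log F` drops by at least `log 2` over the length `8 / M`, and
log-concavity preserves this rate afterwards. -/
theorem IsLogConcave.le_mul_exp_of_half_max {F : ℝ → ℝ} (hF : IsLogConcave F)
    (hint : Integrable F) (h1 : ∫ x, F x = 1) {M : ℝ} (hM0 : 0 < M)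
    (hM : ∀ x, F x ≤ M) {s₀ : ℝ} (hs₀ : M / 2 ≤ F s₀) (r : ℝ) :
    F (s₀ + r) ≤ 2 * M * Real.exp (-(M * Real.log 2 / 8 * r)) := by
  set L := 8 / M with hL
  have hL0 : 0 < L := by positivity
  have hlog : 0 < Real.log 2 := Real.log_pos (by norm_num)
  rcases le_total r L with h | h
  · refine (hM _).trans ?_
    have : M * Real.log 2 / 8 * r ≤ Real.log 2 := by
      calc _ ≤ M * Real.log 2 / 8 * L := by gcongr
        _ = _ := by rw [hL]; field_simp
    have h2 : Real.exp (-Real.log 2) ≤ Real.exp (-(M * Real.log 2 / 8 * r)) := by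
      gcongr
    rw [Real.exp_neg, Real.exp_log (by norm_num)] at h2
    nlinarith
  have hquarter : F (s₀ + L) ≤ M / 4 := by
    by_contra! hcon
    have h2 : ∫ x in s₀..(s₀ + L), M / 4 ≤ ∫ x in s₀..(s₀ + L), F x := by
      refine intervalIntegral.integral_mono_on (by linarith) (by simp) hint.intervalIntegrable
        fun x hx => ?_
      exact le_trans (le_min (by linarith) hcon.le) (hF.min_le hx.1 hx.2)
    have h3 : ∫ x in s₀..(s₀ + L), F x ≤ ∫ x, F x := by
      rw [intervalIntegral.integral_of_le (by linarith)]
      exact setIntegral_le_integral hint (.of_forall hF.nonneg)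
    rw [intervalIntegral.integral_const, smul_eq_mul] at h2
    have : (s₀ + L - s₀) * (M / 4) = 2 := by rw [hL]; field_simp; ring
    linarith
  rcases (hF.nonneg (s₀ + L)).eq_or_lt with h0 | h0
  · have h2 := hF.min_le (x := s₀) (y := s₀ + r) (z := s₀ + L) (by linarith) (by linarith)
    rw [← h0] at h2
    rcases min_le_iff.1 h2 with h3 | h3
    · linarith
    · exact h3.trans (by positivity)
  have hFs : 0 < F s₀ := by linarith
  have h2 := hF.le_mul_exp (x := s₀ + L) (ε := L) (r := r - L) hL0 (by linarith) h0 (by simpa)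
  rw [add_sub_cancel_right, show s₀ + L + (r - L) = s₀ + r by ring] at h2
  have h3 : Real.log 2 ≤ Real.log (F s₀) - Real.log (F (s₀ + L)) := by
    rw [← Real.log_div hFs.ne' h0.ne']
    refine Real.log_le_log (by norm_num) ?_
    rw [le_div_iff₀ h0]
    linarith
  calc F (s₀ + r) ≤ _ := h2
    _ ≤ M / 4 * Real.exp (-(Real.log 2 / L * (r - L))) := by
      have : 0 ≤ r - L := by linarith
      gcongr
    _ = M / 4 * (2 * Real.exp (-(M * Real.log 2 / 8 * r))) := by
      congr 1
      rw [show -(Real.log 2 / L * (r - L)) = Real.log 2 + -(M * Real.log 2 / 8 * r) by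
        rw [hL]; field_simp; ring, Real.exp_add, Real.exp_log (by norm_num)]
    _ ≤ _ := by nlinarith [Real.exp_pos (-(M * Real.log 2 / 8 * r))]

/-- The second moment of a log-concave probability density about a point where it is at least
half its maximum `M` is `O(1 / M ^ 2)`. -/
theorem IsLogConcave.lintegral_sq_mul_le {F : ℝ → ℝ} (hF : IsLogConcave F)
    (hint : Integrable F) (h1 : ∫ x, F x = 1) {M : ℝ} (hM0 : 0 < M)
    (hM : ∀ x, F x ≤ M) {s₀ : ℝ} (hs₀ : M / 2 ≤ F s₀) :
    ∫⁻ s, ENNReal.ofReal ((s - s₀) ^ 2) * ENNReal.ofReal (F s)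
      ≤ ENNReal.ofReal (32768 / M ^ 2) := by
  have hlog : 1 / 2 < Real.log 2 := by have := Real.log_two_gt_d9; linarith
  set c := M * Real.log 2 / 8 with hc
  have hc0 : 0 < c := by positivity
  have hdecay : ∀ s, F s ≤ 2 * M * Real.exp (-(c * |s - s₀|)) := by
    intro s
    rcases le_total s₀ s with h | h
    · have := hF.le_mul_exp_of_half_max hint h1 hM0 hM hs₀ (s - s₀)
      rwa [add_sub_cancel, ← abs_of_nonneg (sub_nonneg.2 h)] at this
    · have := hF.comp_neg.le_mul_exp_of_half_max hint.comp_neg (by rwa [integral_neg_eq_self])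
        hM0 (fun _ => hM _) (s₀ := -s₀) (by simpa) (s₀ - s)
      rw [abs_of_nonpos (sub_nonpos.2 h), neg_sub]
      simpa using this
  set g : ℝ → ℝ := fun x => 2 * M * (x ^ 2 * Real.exp (-(c * x))) with hg
  have hgv : ∫ x in Set.Ioi 0, g x = 4 * M / c ^ 3 := by
    have := Real.integral_rpow_mul_exp_neg_mul_Ioi (a := 3) (r := c) (by norm_num) hc0
    rw [hg, integral_const_mul]
    have e : ∫ x in Set.Ioi (0 : ℝ), x ^ 2 * Real.exp (-(c * x)) = 2 / c ^ 3 := by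
      have hG : Real.Gamma 3 = 2 := by
        rw [show (3 : ℝ) = (2 : ℕ) + 1 by norm_num, Real.Gamma_nat_eq_factorial]
        norm_num
      rw [hG] at this
      refine Eq.trans (setIntegral_congr_fun measurableSet_Ioi fun x hx => ?_) (this.trans ?_)
      · norm_num
      · rw [show (3 : ℝ) = (3 : ℕ) by norm_num, Real.rpow_natCast]
        field_simp
    rw [e]; ring
  calc ∫⁻ s, ENNReal.ofReal ((s - s₀) ^ 2) * ENNReal.ofReal (F s)
      ≤ ∫⁻ s, ENNReal.ofReal (g |s - s₀|) := by
        refine lintegral_mono fun s => ?_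
        rw [← ENNReal.ofReal_mul (sq_nonneg _)]
        refine ENNReal.ofReal_le_ofReal ?_
        calc _ ≤ (s - s₀) ^ 2 * (2 * M * Real.exp (-(c * |s - s₀|))) := by gcongr; exact hdecay s
          _ = _ := by simp only [hg, sq_abs]; ring
    _ = ∫⁻ s, ENNReal.ofReal (g |s|) := lintegral_sub_right_eq_self (fun s => ENNReal.ofReal (g |s|)) s₀
    _ = ENNReal.ofReal (∫ s, g |s|) := by
        rw [ofReal_integral_eq_lintegral_ofReal]
        -- If `g |s|` were not integrable its Bochner integral would be `0`, contradicting the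
        -- positive value computed from the half-line.
        · by_contra h
          have h2 := integral_comp_abs (f := g)
          rw [integral_undef h, hgv] at h2
          have : 0 < 4 * M / c ^ 3 := by positivity
          linarith
        · refine .of_forall fun s => ?_
          simp only [hg, Pi.zero_apply]; positivity
    _ = ENNReal.ofReal (2 * (4 * M / c ^ 3)) := by rw [integral_comp_abs, hgv]
    _ ≤ _ := by
        refine ENNReal.ofReal_le_ofReal ?_
        rw [mul_div_assoc', div_le_div_iff₀ (by positivity) (by positivity)]
        -- As `log 2 > 1 / 2`, `c ≥ M / 16`, and `8 M (16 / M)³ = 32768 / M²`.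
        have : (M / 16) ^ 3 ≤ c ^ 3 := by
          gcongr
          rw [hc]; nlinarith
        nlinarith

/-! ### Slicing orthogonally to `η`. -/

/-- Measure preserving linear coordinates in which the first coordinate is `⟨η, ·⟩ / ‖η‖`. -/
theorem exists_measurePreserving_slicing {m : ℕ} {η : EuclideanSpace ℝ (Fin (m + 1))}
    (hη : η ≠ 0) :
    ∃ ψ : ℝ × (Fin m → ℝ) →ₗ[ℝ] EuclideanSpace ℝ (Fin (m + 1)),
      MeasurePreserving ψ ∧ ∀ s y, inner ℝ η (ψ (s, y)) = ‖η‖ * s := by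
  have hη' : ‖η‖ ≠ 0 := norm_ne_zero_iff.2 hη
  obtain ⟨b, hb⟩ := Orthonormal.exists_orthonormalBasis_extension_of_card_eq
    (𝕜 := ℝ) (E := EuclideanSpace ℝ (Fin (m + 1))) (ι := Fin (m + 1)) (by simp)
    (v := fun _ => ‖η‖⁻¹ • η) (s := {0}) (by
      rw [orthonormal_subsingleton_iff]
      intro _
      simp [norm_smul, hη'])
  have hb0 : b 0 = ‖η‖⁻¹ • η := hb 0 rfl
  let e₁ := (MeasurableEquiv.piFinSuccAbove (fun _ : Fin (m + 1) => ℝ) 0).symm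
  let ψ : ℝ × (Fin m → ℝ) →ₗ[ℝ] EuclideanSpace ℝ (Fin (m + 1)) :=
    { toFun := fun p => b.repr.symm (WithLp.toLp 2 (e₁ p))
      map_add' := by
        intro p q
        rw [← map_add, ← WithLp.toLp_add]
        congr 2
        ext i
        refine Fin.cases ?_ (fun j => ?_) i <;> simp [e₁]
      map_smul' := by
        intro r p
        rw [RingHom.id_apply, ← map_smul, ← WithLp.toLp_smul]
        congr 2
        ext i
        refine Fin.cases ?_ (fun j => ?_) i <;> simp [e₁] }
  refine ⟨ψ, ?_, fun s y => ?_⟩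
  · have h1 := (volume_preserving_piFinSuccAbove (fun _ : Fin (m + 1) => ℝ) 0).symm
    exact b.repr.symm.measurePreserving.comp ((PiLp.volume_preserving_toLp (Fin (m + 1))).comp h1)
  · have : η = ‖η‖ • b 0 := by rw [hb0, smul_smul, mul_inv_cancel₀ hη', one_smul]
    conv_lhs => rw [this]
    rw [inner_smul_left, ← b.repr_apply_apply]
    simp [ψ, e₁]

section Slice

variable {m : ℕ} {E : Type*} [AddCommGroup E] [Module ℝ E] [MeasurableSpace E]

/-- Integrals of `w` over the slices `{s} × ℝᵐ` in the coordinates `ψ`. -/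
noncomputable def sliceIntegral (ψ : ℝ × (Fin m → ℝ) →ₗ[ℝ] E) (w : E → ℝ≥0∞) (s : ℝ) : ℝ≥0∞ :=
  ∫⁻ y, w (ψ (s, y))

variable {ψ : ℝ × (Fin m → ℝ) →ₗ[ℝ] E} {w : E → ℝ≥0∞}

theorem measurable_sliceIntegral (hψ : Measurable ψ) (hw : Measurable w) :
    Measurable (sliceIntegral ψ w) :=
  Measurable.lintegral_prod_right' (f := fun p => w (ψ p)) (hw.comp hψ)

theorem lintegral_mul_sliceIntegral {μ : Measure E} (hψ : MeasurePreserving ψ volume μ)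
    (hw : Measurable w) {g : ℝ → ℝ≥0∞} (hg : Measurable g) {ℓ : E → ℝ} (hℓ : Measurable ℓ)
    (hℓψ : ∀ s y, ℓ (ψ (s, y)) = s) :
    ∫⁻ s, g s * sliceIntegral ψ w s = ∫⁻ x, g (ℓ x) * w x ∂μ := by
  have hψm := hψ.measurable
  rw [← hψ.lintegral_comp (by fun_prop), Measure.volume_eq_prod, lintegral_prod _ (by fun_prop)]
  simp only [hℓψ]
  refine lintegral_congr fun s => ?_
  rw [sliceIntegral, lintegral_const_mul _ (by fun_prop)]

theorem lintegral_sliceIntegral {μ : Measure E} (hψ : MeasurePreserving ψ volume μ)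
    (hw : Measurable w) : ∫⁻ s, sliceIntegral ψ w s = ∫⁻ x, w x ∂μ := by
  have hψm := hψ.measurable
  rw [← hψ.lintegral_comp hw, Measure.volume_eq_prod, lintegral_prod _ (by fun_prop)]
  rfl

theorem sliceIntegral_logConcave (hψ : Measurable ψ) (hw : Measurable w)
    (H : ∀ x y, ∀ a b : ℝ, 0 < a → 0 < b → a + b = 1 → w x ^ a * w y ^ b ≤ w (a • x + b • y))
    (s t a b : ℝ) (ha : 0 < a) (hb : 0 < b) (hab : a + b = 1) :
    sliceIntegral ψ w s ^ a * sliceIntegral ψ w t ^ b ≤ sliceIntegral ψ w (a * s + b * t) := by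
  refine prekopaLeindler_pi (by fun_prop) (by fun_prop) (by fun_prop) ha hb hab fun y z => ?_
  have : ψ (a * s + b * t, a • y + b • z) = a • ψ (s, y) + b • ψ (t, z) := by
    rw [← map_smul, ← map_smul, ← map_add]
    simp
  rw [this]
  exact H _ _ a b ha hb hab

/-- Improved midpoint log-concavity of `w` on a set `G` passes to the slice integrals. -/
theorem sliceIntegral_midpoint_gain (hψ : Measurable ψ) (hw : Measurable w)
    (H : ∀ x y, w x ^ (1 / 2 : ℝ) * w y ^ (1 / 2 : ℝ) ≤ w ((1 / 2 : ℝ) • x + (1 / 2 : ℝ) • y))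
    {G : Set E} (hG : MeasurableSet G) {ε c : ℝ} (hc0 : 0 ≤ c) (hc1 : c ≤ 1)
    (hGε : ∀ z ∈ G, ∀ y, w (z - ψ (ε, y)) ^ (1 / 2 : ℝ) * w (z + ψ (ε, y)) ^ (1 / 2 : ℝ)
      ≤ ENNReal.ofReal (1 - c) * w z) (s : ℝ) :
    sliceIntegral ψ w (s - ε) ^ (1 / 2 : ℝ) * sliceIntegral ψ w (s + ε) ^ (1 / 2 : ℝ) +
      ENNReal.ofReal c * sliceIntegral ψ (G.indicator w) s ≤ sliceIntegral ψ w s := by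
  classical
  -- Prékopa–Leindler is applied with `v` as target: its hypothesis only sees the midpoint, so the
  -- target may be lowered by the factor `1 - c` at midpoints in `G`.
  set v : E → ℝ≥0∞ := G.piecewise (fun z => ENNReal.ofReal (1 - c) * w z) w with hv
  have hvm : Measurable v := Measurable.piecewise hG (by fun_prop) hw
  have hsum : ∀ z, v z + ENNReal.ofReal c * G.indicator w z = w z := fun z => by
    by_cases hz : z ∈ G
    · rw [hv, Set.piecewise_eq_of_mem _ _ _ hz, Set.indicator_of_mem hz, ← add_mul,
        ← ENNReal.ofReal_add (by linarith) hc0]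
      simp
    · simp [hv, hz]
  have hPL : sliceIntegral ψ w (s - ε) ^ (1 / 2 : ℝ) * sliceIntegral ψ w (s + ε) ^ (1 / 2 : ℝ)
      ≤ sliceIntegral ψ v s := by
    refine prekopaLeindler_pi (by fun_prop) (by fun_prop) (by fun_prop) (by norm_num) (by norm_num)
      (by norm_num) fun y z => ?_
    set x := ψ (s, (1 / 2 : ℝ) • y + (1 / 2 : ℝ) • z) with hx
    set u := ψ (ε, (1 / 2 : ℝ) • z - (1 / 2 : ℝ) • y) with hu
    have e1 : ψ (s - ε, y) = x - u := by
      rw [hx, hu, ← map_sub]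
      congr 2
      module
    have e2 : ψ (s + ε, z) = x + u := by
      rw [hx, hu, ← map_add]
      simp only [Prod.mk_add_mk]
      congr 2
      module
    rw [e1, e2]
    by_cases hxG : x ∈ G
    · rw [hv, Set.piecewise_eq_of_mem _ _ _ hxG]
      exact hGε x hxG _
    · rw [hv, Set.piecewise_eq_of_notMem _ _ _ hxG]
      refine (H _ _).trans_eq ?_
      congr 1
      module
  calc _ ≤ sliceIntegral ψ v s + ENNReal.ofReal c * sliceIntegral ψ (G.indicator w) s := by gcongr
    _ = sliceIntegral ψ w s := by
      have := hw.indicator hG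
      rw [sliceIntegral, sliceIntegral, ← lintegral_const_mul _ (by fun_prop),
        ← lintegral_add_left (by fun_prop)]
      simp only [hsum]
      rfl

end Slice

/-! ### Densities with a Gaussian factor. -/

section Weight

variable {E : Type*} [NormedAddCommGroup E]

/-- The density `exp (-φ - δ ‖·‖² / 2)` on `D`, extended by zero. -/
noncomputable def gaussWeight (D : Set E) (φ : E → ℝ) (δ : ℝ) : E → ℝ≥0∞ :=
  D.indicator fun x => ENNReal.ofReal (Real.exp (-(φ x + δ / 2 * ‖x‖ ^ 2)))

variable {D : Set E} {φ : E → ℝ} {δ : ℝ}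

theorem gaussWeight_of_mem {x : E} (hx : x ∈ D) :
    gaussWeight D φ δ x = ENNReal.ofReal (Real.exp (-(φ x + δ / 2 * ‖x‖ ^ 2))) :=
  Set.indicator_of_mem hx _

theorem gaussWeight_of_notMem {x : E} (hx : x ∉ D) : gaussWeight D φ δ x = 0 :=
  Set.indicator_of_notMem hx _

theorem gaussWeight_le (hδ : 0 ≤ δ) (x : E) : gaussWeight D φ δ x ≤ gaussWeight D φ 0 x := by
  by_cases hx : x ∈ D
  · rw [gaussWeight_of_mem hx, gaussWeight_of_mem hx]
    gcongr
  · rw [gaussWeight_of_notMem hx]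
    exact bot_le

/-- Guarantees that the Gaussian factor costs at most half of the mass inside a fixed ball once `δ`
is small. -/
theorem le_gaussWeight {R : ℝ} (hR : δ * R ^ 2 ≤ 1) (hδ : 0 ≤ δ) {x : E} (hx : ‖x‖ ≤ R) :
    ENNReal.ofReal (1 / 2) * gaussWeight D φ 0 x ≤ gaussWeight D φ δ x := by
  by_cases hxD : x ∈ D
  · rw [gaussWeight_of_mem hxD, gaussWeight_of_mem hxD, ← ENNReal.ofReal_mul (by norm_num)]
    refine ENNReal.ofReal_le_ofReal ?_
    rw [neg_add, Real.exp_add, neg_add, Real.exp_add, zero_div, zero_mul, neg_zero, Real.exp_zero,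
      mul_one, mul_comm]
    gcongr
    have h1 : δ * ‖x‖ ^ 2 ≤ δ * R ^ 2 := by gcongr
    have h2 := Real.add_one_le_exp (-(δ / 2 * ‖x‖ ^ 2))
    linarith
  · simp [gaussWeight_of_notMem hxD]

theorem continuousOn_gaussWeight (hφ : ContinuousOn φ D) :
    ContinuousOn (gaussWeight D φ δ) D := by
  refine ContinuousOn.congr (f := fun x => ENNReal.ofReal (Real.exp (-(φ x + δ / 2 * ‖x‖ ^ 2)))) ?_
    fun x hx => gaussWeight_of_mem hx
  exact ENNReal.continuous_ofReal.comp_continuousOn (by fun_prop)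

theorem measurable_gaussWeight [MeasurableSpace E] [BorelSpace E] (hD : IsOpen D)
    (hφ : ContinuousOn φ D) : Measurable (gaussWeight D φ δ) := by
  classical
  rw [gaussWeight, ← Set.piecewise_eq_indicator]
  refine ContinuousOn.measurable_piecewise ?_ continuousOn_const hD.measurableSet
  exact ENNReal.continuous_ofReal.comp_continuousOn (by fun_prop)

theorem gaussWeight_logConcave [NormedSpace ℝ E] (hδ : 0 ≤ δ) (hφ : ConvexOn ℝ D φ) (x y : E)
    (a b : ℝ) (ha : 0 < a) (hb : 0 < b) (hab : a + b = 1) :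
    gaussWeight D φ δ x ^ a * gaussWeight D φ δ y ^ b ≤ gaussWeight D φ δ (a • x + b • y) := by
  by_cases hx : x ∈ D
  · by_cases hy : y ∈ D
    · rw [gaussWeight_of_mem hx, gaussWeight_of_mem hy,
        gaussWeight_of_mem (hφ.1 hx hy ha.le hb.le hab),
        ENNReal.ofReal_rpow_of_pos (Real.exp_pos _), ENNReal.ofReal_rpow_of_pos (Real.exp_pos _),
        ← ENNReal.ofReal_mul (by positivity), ← Real.exp_mul, ← Real.exp_mul, ← Real.exp_add]
      refine ENNReal.ofReal_le_ofReal (Real.exp_le_exp.2 ?_)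
      have h1 := hφ.2 hx hy ha.le hb.le hab
      have h2 : ‖a • x + b • y‖ ^ 2 ≤ a * ‖x‖ ^ 2 + b * ‖y‖ ^ 2 := by
        have h3 : ‖a • x + b • y‖ ≤ a * ‖x‖ + b * ‖y‖ :=
          (norm_add_le _ _).trans_eq (by rw [norm_smul, norm_smul, Real.norm_of_nonneg ha.le,
            Real.norm_of_nonneg hb.le])
        obtain rfl : b = 1 - a := by linarith
        calc _ ≤ (a * ‖x‖ + (1 - a) * ‖y‖) ^ 2 := by gcongr
          _ ≤ _ := by nlinarith [mul_nonneg (mul_nonneg ha.le hb.le) (sq_nonneg (‖x‖ - ‖y‖))]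
      simp only [smul_eq_mul] at h1
      nlinarith
    · simp [gaussWeight_of_notMem hy, hb]
  · simp [gaussWeight_of_notMem hx, ha]

end Weight

/-! ### Points with a uniform midpoint gain. -/

section GainSet

variable {E : Type*} [NormedAddCommGroup E] [InnerProductSpace ℝ E]

/-- Points of `D` at which the midpoint inequality for `gaussWeight D φ δ` improves by
`κ ⟨η, u⟩ ^ 2` for every increment `u` with `|⟨η, u⟩| ≤ ρ`. -/
def gainSet (D : Set E) (φ : E → ℝ) (δ : ℝ) (η : E) (κ ρ : ℝ) : Set E :=
  {z | z ∈ D ∧ ∀ u, |inner ℝ η u| ≤ ρ → gaussWeight D φ δ (z - u) * gaussWeight D φ δ (z + u) ≤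
    ENNReal.ofReal (Real.exp (-(2 * κ * inner ℝ η u ^ 2))) * gaussWeight D φ δ z ^ 2}

variable {D : Set E} {φ : E → ℝ} {δ : ℝ} {η : E} {κ ρ : ℝ}

/-- For each `u`, failure of the gain is an open condition on `z`, because the product vanishes
unless `z ± u ∈ D` and the weight is continuous on `D`. Hence even the uncountable union over `u` is
open. -/
theorem measurableSet_gainSet [MeasurableSpace E] [BorelSpace E] (hD : IsOpen D)
    (hφ : ContinuousOn φ D) : MeasurableSet (gainSet D φ δ η κ ρ) := by
  set w := gaussWeight D φ δ with hw
  have hwc : ContinuousOn w D := continuousOn_gaussWeight hφ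
  have hwt : ∀ x, w x ≠ ⊤ := fun x => by
    by_cases hx : x ∈ D
    · rw [hw, gaussWeight_of_mem hx]; exact ENNReal.ofReal_ne_top
    · rw [hw, gaussWeight_of_notMem hx]; exact ENNReal.zero_ne_top
  have key : gainSet D φ δ η κ ρ = D \ ⋃ u ∈ {u | |inner ℝ η u| ≤ ρ},
      ({z | z ∈ D ∧ z - u ∈ D ∧ z + u ∈ D} ∩
        {z | ENNReal.ofReal (Real.exp (-(2 * κ * inner ℝ η u ^ 2))) * w z ^ 2
          < w (z - u) * w (z + u)}) := by
    ext z
    simp only [gainSet, Set.mem_ofPred_eq, Set.mem_sdiff, Set.mem_iUnion, Set.mem_inter_iff,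
      exists_prop, not_exists, not_and, not_lt]
    refine and_congr_right fun hz => forall₂_congr fun u hu => ⟨fun h _ => h, fun h => ?_⟩
    by_cases h1 : z - u ∈ D
    · by_cases h2 : z + u ∈ D
      · exact h ⟨hz, h1, h2⟩
      · simp [gaussWeight_of_notMem h2]
    · simp [gaussWeight_of_notMem h1]
  rw [key]
  refine hD.measurableSet.diff (isOpen_biUnion fun u _ => ?_).measurableSet
  have ho : IsOpen {z | z ∈ D ∧ z - u ∈ D ∧ z + u ∈ D} :=
    hD.inter ((hD.preimage (continuous_id.sub continuous_const)).inter
      (hD.preimage (continuous_id.add continuous_const)))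
  rw [isOpen_iff_mem_nhds]
  rintro z ⟨hzD, hz⟩
  have c0 : ContinuousAt w z := hwc.continuousAt (hD.mem_nhds hzD.1)
  have c1 : ContinuousAt (fun z => w (z - u)) z :=
    ContinuousAt.comp (f := fun z => z - u) (hwc.continuousAt (hD.mem_nhds hzD.2.1)) (by fun_prop)
  have c2 : ContinuousAt (fun z => w (z + u)) z :=
    ContinuousAt.comp (f := fun z => z + u) (hwc.continuousAt (hD.mem_nhds hzD.2.2)) (by fun_prop)
  have c3 : ContinuousAt (fun z => w (z - u) * w (z + u)) z :=
    ENNReal.Tendsto.mul c1 (.inr (hwt _)) c2 (.inr (hwt _))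
  have c4 : ContinuousAt (fun z => ENNReal.ofReal (Real.exp (-(2 * κ * inner ℝ η u ^ 2))) * w z ^ 2)
      z := ENNReal.Tendsto.const_mul ((ENNReal.continuous_pow 2).continuousAt.comp c0)
        (.inr ENNReal.ofReal_ne_top)
  exact Filter.inter_mem (ho.mem_nhds hzD) (c4.eventually_lt c3 hz)

/-- A second-order lower bound for the symmetric differences of the convex function `φ` at `z`
puts `z` into a gain set. -/
theorem exists_mem_gainSet (hδ : 0 < δ) (hκ : 0 < κ) (hφ : ConvexOn ℝ D φ) {z : E} (hz : z ∈ D)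
    (H : ∀ᶠ u in 𝓝 (0 : E), 2 * κ * inner ℝ η u ^ 2 - δ * ‖u‖ ^ 2 ≤ φ (z + u) + φ (z - u) - 2 * φ z) :
    ∃ k : ℕ, z ∈ gainSet D φ δ η κ (1 / (k + 1)) := by
  obtain ⟨r, hr, hrH⟩ := Metric.eventually_nhds_iff.1 H
  -- With `ρ` this small, `|⟨η, u⟩| ≤ ρ` forces `2 κ ⟨η, u⟩² ≤ δ r²`, so for `‖u‖ ≥ r` the Gaussian
  -- term alone provides the gain.
  obtain ⟨k, hk⟩ := exists_nat_one_div_lt (show 0 < min 1 (δ * r ^ 2 / (2 * κ)) by positivity)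
  refine ⟨k, hz, fun u hu => ?_⟩
  by_cases h1 : z - u ∈ D
  swap; · simp [gaussWeight_of_notMem h1]
  by_cases h2 : z + u ∈ D
  swap; · simp [gaussWeight_of_notMem h2]
  rw [gaussWeight_of_mem h1, gaussWeight_of_mem h2, gaussWeight_of_mem hz,
    ← ENNReal.ofReal_pow (Real.exp_pos _).le, ← ENNReal.ofReal_mul (Real.exp_pos _).le,
    ← ENNReal.ofReal_mul (Real.exp_pos _).le, ← Real.exp_nat_mul, ← Real.exp_add, ← Real.exp_add]
  refine ENNReal.ofReal_le_ofReal (Real.exp_le_exp.2 ?_)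
  -- The Gaussian exponent contributes exactly `δ ‖u‖²` to the symmetric difference.
  have hpar := parallelogram_law_with_norm ℝ z u
  have hconv : 0 ≤ φ (z + u) + φ (z - u) - 2 * φ z := by
    have := hφ.2 h1 h2 (show (0 : ℝ) ≤ 1 / 2 by norm_num) (show (0 : ℝ) ≤ 1 / 2 by norm_num)
      (by norm_num)
    rw [show (1 / 2 : ℝ) • (z - u) + (1 / 2 : ℝ) • (z + u) = z by module] at this
    simp only [smul_eq_mul] at this
    linarith
  have hgain : 2 * κ * inner ℝ η u ^ 2 - δ * ‖u‖ ^ 2 ≤ φ (z + u) + φ (z - u) - 2 * φ z := by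
    rcases lt_or_ge ‖u‖ r with h | h
    · exact hrH (by simpa using h)
    · have h3 : inner ℝ η u ^ 2 ≤ δ * r ^ 2 / (2 * κ) := by
        have h4 := hk.le.trans (min_le_right _ _)
        have h5 := hu.trans (hk.le.trans (min_le_left _ _))
        rw [← sq_abs]
        have := abs_nonneg (inner ℝ η u)
        nlinarith
      rw [le_div_iff₀ (by positivity)] at h3
      have h4 : δ * r ^ 2 ≤ δ * ‖u‖ ^ 2 := by gcongr
      linarith
  push_cast
  nlinarith

theorem monotone_gainSet : Monotone fun k : ℕ => gainSet D φ δ η κ (1 / (k + 1)) := by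
  intro k l hkl z hz
  exact ⟨hz.1, fun u hu => hz.2 u (hu.trans (by gcongr))⟩

end GainSet

/-! ### From gains to a lower bound on the marginal's supremum and a variance bound. -/

/-- Continuity from below along increasing unions holds for the outer measure of arbitrary sets, so
measurability of `A` and of the `S k` is not needed. -/
theorem exists_inter_gt_of_subset_iUnion {α : Type*} [MeasurableSpace α] {μ : Measure α}
    {A : Set α} {S : ℕ → Set α} (hS : Monotone S) (hA : A ⊆ ⋃ k, S k) {c : ℝ≥0∞} (hc : c < μ A) :
    ∃ k, c < μ (A ∩ S k) := by
  have h1 : A = ⋃ k, A ∩ S k := by rw [← Set.inter_iUnion, Set.inter_eq_left.2 hA]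
  have h2 : μ A = ⨆ k, μ (A ∩ S k) := by
    conv_lhs => rw [h1]
    exact Monotone.measure_iUnion fun i j hij => Set.inter_subset_inter_right _ (hS hij)
  rw [h2] at hc
  exact lt_iSup_iff.1 hc

theorem isLogConcave_toReal {F : ℝ → ℝ≥0∞} (hb : ∀ x, F x ≠ ⊤)
    (hF : ∀ x y a b : ℝ, 0 < a → 0 < b → a + b = 1 → F x ^ a * F y ^ b ≤ F (a * x + b * y)) :
    IsLogConcave fun x => (F x).toReal where
  nonneg _ := ENNReal.toReal_nonneg
  rpow_mul_le x y a b ha hb' hab := by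
    rw [ENNReal.toReal_rpow, ENNReal.toReal_rpow, ← ENNReal.toReal_mul]
    exact ENNReal.toReal_mono (hb _) (hF x y a b ha hb' hab)

/-- If the midpoint gains of `φ` along `η` are asymptotically at least `κ ⟨η, u⟩ ^ 2` on `A`, then
the slice densities of `exp (-φ)` orthogonally to `η` are bounded below in terms of the mass
of `A`. -/
theorem mul_measure_sq_le_sliceIntegral {m : ℕ} {D : Set (EuclideanSpace ℝ (Fin (m + 1)))}
    {φ : EuclideanSpace ℝ (Fin (m + 1)) → ℝ} (hD : IsOpen D) (hφ : ConvexOn ℝ D φ)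
    (hφc : ContinuousOn φ D) {η : EuclideanSpace ℝ (Fin (m + 1))} (hη : η ≠ 0)
    {ψ : ℝ × (Fin m → ℝ) →ₗ[ℝ] EuclideanSpace ℝ (Fin (m + 1))} (hψ : MeasurePreserving ψ)
    (hψη : ∀ s y, inner ℝ η (ψ (s, y)) = ‖η‖ * s)
    {A : Set (EuclideanSpace ℝ (Fin (m + 1)))} {κ : ℝ} (hκ : 0 < κ)
    (hA : ∀ z ∈ A, z ∈ D ∧ ∀ δ > 0, ∀ᶠ u in 𝓝 0,
      2 * κ * inner ℝ η u ^ 2 - δ * ‖u‖ ^ 2 ≤ φ (z + u) + φ (z - u) - 2 * φ z)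
    (hfin : ∫⁻ x, gaussWeight D φ 0 x ≠ ⊤) {M : ℝ} (hM0 : 0 < M)
    (hM : ∀ s, sliceIntegral ψ (gaussWeight D φ 0) s ≤ ENNReal.ofReal M) {p : ℝ} (hp : 0 < p)
    (hpA : ENNReal.ofReal p < (volume.withDensity (gaussWeight D φ 0)) A) :
    κ * ‖η‖ ^ 2 * (p / 2) ^ 2 ≤ 32 * M ^ 2 := by
  have hη0 : 0 < ‖η‖ := norm_pos_iff.2 hη
  set μ := volume.withDensity (gaussWeight D φ 0) with hμ
  have hψm := hψ.measurable
  obtain ⟨R, hR⟩ := exists_inter_gt_of_subset_iUnion (μ := μ) (A := A)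
    (S := fun k : ℕ => Metric.closedBall 0 (k : ℝ))
    (fun i j hij => Metric.closedBall_subset_closedBall (by exact_mod_cast hij))
    (by rw [Metric.iUnion_closedBall_nat]; exact Set.subset_univ _) hpA
  -- The order of choices matters: the radius `R` first, then `δ` depending on `R`, then the scale
  -- `1 / (k + 1)` of the gain depending on `δ`.
  obtain ⟨δ, hδ, hδR⟩ : ∃ δ : ℝ, 0 < δ ∧ δ * (R : ℝ) ^ 2 ≤ 1 :=
    ⟨1 / ((R : ℝ) ^ 2 + 1), by positivity, by
      rw [div_mul_eq_mul_div, div_le_one (by positivity)]; linarith⟩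
  obtain ⟨k, hk⟩ := exists_inter_gt_of_subset_iUnion (μ := μ)
    (S := fun k : ℕ => gainSet D φ δ η κ (1 / (k + 1))) monotone_gainSet
    (fun z hz => Set.mem_iUnion.2 (exists_mem_gainSet hδ hκ hφ (hA z hz.1).1
      ((hA z hz.1).2 δ hδ))) hR
  set G := gainSet D φ δ η κ (1 / (k + 1)) with hG
  have hGm : MeasurableSet G := measurableSet_gainSet hD hφc
  have hw0 : Measurable (gaussWeight D φ 0) := measurable_gaussWeight hD hφc
  set w := gaussWeight D φ δ with hw
  have hwm : Measurable w := measurable_gaussWeight hD hφc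
  have hwle : ∀ x, w x ≤ gaussWeight D φ 0 x := gaussWeight_le hδ.le
  have hwlc := gaussWeight_logConcave (δ := δ) hδ.le hφ
  have hmass : ENNReal.ofReal (p / 2) ≤ ∫⁻ x, G.indicator w x := by
    have hm : MeasurableSet (Metric.closedBall 0 (R : ℝ) ∩ G) :=
      Metric.isClosed_closedBall.measurableSet.inter hGm
    calc ENNReal.ofReal (p / 2) = ENNReal.ofReal (1 / 2) * ENNReal.ofReal p := by
          rw [← ENNReal.ofReal_mul (by norm_num)]; ring_nf
      _ ≤ ENNReal.ofReal (1 / 2) * μ (Metric.closedBall 0 (R : ℝ) ∩ G) := by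
          gcongr
          exact hk.le.trans (measure_mono (Set.inter_subset_inter_left _ Set.inter_subset_right))
      _ = ∫⁻ x in Metric.closedBall 0 (R : ℝ) ∩ G,
            ENNReal.ofReal (1 / 2) * gaussWeight D φ 0 x := by
          rw [hμ, withDensity_apply _ hm, lintegral_const_mul _ hw0]
      _ ≤ ∫⁻ x in Metric.closedBall 0 (R : ℝ) ∩ G, w x :=
          setLIntegral_mono hwm fun x hx => le_gaussWeight hδR hδ.le (by simpa using hx.1)
      _ ≤ ∫⁻ x in G, w x := lintegral_mono_set Set.inter_subset_right
      _ = _ := (lintegral_indicator hGm _).symm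
  set F := sliceIntegral ψ w with hF
  set q := sliceIntegral ψ (G.indicator w) with hq
  have hFM : ∀ s, F s ≤ ENNReal.ofReal M := fun s =>
    (lintegral_mono fun y => hwle _).trans (hM s)
  have hFt : ∀ s, F s ≠ ⊤ := fun s => ne_top_of_le_ne_top ENNReal.ofReal_ne_top (hFM s)
  have hqF : ∀ s, q s ≤ F s := fun s => lintegral_mono fun y => Set.indicator_le_self _ _ _
  have hqt : ∀ s, q s ≠ ⊤ := fun s => ne_top_of_le_ne_top (hFt s) (hqF s)
  have hFm : Measurable F := measurable_sliceIntegral hψm hwm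
  have hqm : Measurable q := measurable_sliceIntegral hψm (hwm.indicator hGm)
  have hFi : ∫⁻ s, F s ≠ ⊤ := by
    rw [hF, lintegral_sliceIntegral hψ hwm]
    exact ne_top_of_le_ne_top hfin (lintegral_mono hwle)
  have hFlc := isLogConcave_toReal hFt (sliceIntegral_logConcave hψm hwm hwlc)
  -- An increment `ψ (ε, y)` has `⟨η, ψ (ε, y)⟩ = ‖η‖ ε` for every `y`; hence the gain constant `κ
  -- ‖η‖²` and the range `ε ≤ 1 / ((k + 1) ‖η‖)`.
  refine hFlc.mul_sq_le_of_midpoint_gain (q := fun s => (q s).toReal) (ε₀ := 1 / (k + 1) / ‖η‖)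
    (by fun_prop) (integrable_toReal_of_lintegral_ne_top hFm.aemeasurable hFi) hM0
    (fun s => ENNReal.toReal_le_of_le_ofReal hM0.le (hFM s)) (by fun_prop)
    (fun _ => ENNReal.toReal_nonneg) (fun s => ENNReal.toReal_mono (hFt s) (hqF s)) (by positivity)
    ?_ (by positivity) (by positivity) ?_
  · have hqi : ∫⁻ s, q s ≠ ⊤ := ne_top_of_le_ne_top hFi (lintegral_mono hqF)
    rw [integral_toReal hqm.aemeasurable (.of_forall fun s => (hqt s).lt_top),
      ← ENNReal.ofReal_le_iff_le_toReal hqi, hq, lintegral_sliceIntegral hψ (hwm.indicator hGm)]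
    exact hmass
  · intro ε hε hεk s
    have hexp1 : Real.exp (-(κ * ‖η‖ ^ 2 * ε ^ 2)) ≤ 1 := Real.exp_le_one_iff.2 (by
      have : 0 ≤ κ * ‖η‖ ^ 2 * ε ^ 2 := by positivity
      linarith)
    have hexp0 := Real.exp_pos (-(κ * ‖η‖ ^ 2 * ε ^ 2))
    set c := 1 - Real.exp (-(κ * ‖η‖ ^ 2 * ε ^ 2)) with hc
    have hgain := sliceIntegral_midpoint_gain hψm hwm
      (fun x y => hwlc x y _ _ (by norm_num) (by norm_num) (by norm_num)) hGm (ε := ε) (c := c)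
      (by linarith) (by linarith) (fun z hz y => by
        have h1 := hz.2 (ψ (ε, y)) (by
          rw [hψη, abs_of_nonneg (by positivity), ← le_div_iff₀' hη0]
          exact hεk)
        rw [hψη] at h1
        rw [← ENNReal.mul_rpow_of_nonneg _ _ (by norm_num)]
        refine (ENNReal.rpow_le_rpow h1 (by norm_num)).trans_eq ?_
        rw [ENNReal.mul_rpow_of_nonneg _ _ (by norm_num), ENNReal.ofReal_rpow_of_pos (Real.exp_pos _),
          ← Real.exp_mul, ← ENNReal.rpow_natCast, ← ENNReal.rpow_mul, hc, sub_sub_cancel]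
        norm_num
        ring_nf
        rfl) s
    have h2 := ENNReal.toReal_mono (hFt s) hgain
    have t : ∀ s, F s ^ (1 / 2 : ℝ) ≠ ⊤ := fun s =>
      ENNReal.rpow_ne_top_of_nonneg (by norm_num) (hFt s)
    rw [ENNReal.toReal_add (ENNReal.mul_ne_top (t _) (t _))
      (ENNReal.mul_ne_top ENNReal.ofReal_ne_top (hqt s)), ENNReal.toReal_mul, ENNReal.toReal_mul,
      ENNReal.toReal_ofReal (by linarith), ← ENNReal.toReal_rpow, ← ENNReal.toReal_rpow] at h2
    rw [Real.sqrt_mul ENNReal.toReal_nonneg, Real.sqrt_eq_rpow, Real.sqrt_eq_rpow]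
    linarith

/-- The quantile inequality for second moments about a suitable point. -/
theorem exists_lintegral_sq_le {m : ℕ} {D : Set (EuclideanSpace ℝ (Fin (m + 1)))}
    {φ : EuclideanSpace ℝ (Fin (m + 1)) → ℝ} (hD : IsOpen D) (hφ : ConvexOn ℝ D φ)
    (hφc : ContinuousOn φ D) {η : EuclideanSpace ℝ (Fin (m + 1))} (hη : η ≠ 0)
    {A : Set (EuclideanSpace ℝ (Fin (m + 1)))} {κ : ℝ} (hκ : 0 < κ)
    (hA : ∀ z ∈ A, z ∈ D ∧ ∀ δ > 0, ∀ᶠ u in 𝓝 0,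
      2 * κ * inner ℝ η u ^ 2 - δ * ‖u‖ ^ 2 ≤ φ (z + u) + φ (z - u) - 2 * φ z)
    (hprob : ∫⁻ x, gaussWeight D φ 0 x = 1) {p : ℝ} (hp : 0 < p)
    (hpA : ENNReal.ofReal p < (volume.withDensity (gaussWeight D φ 0)) A) :
    ∃ c : ℝ, ∫⁻ x, ENNReal.ofReal ((inner ℝ η x - c) ^ 2) ∂(volume.withDensity (gaussWeight D φ 0))
      ≤ ENNReal.ofReal (2 ^ 22 / (κ * p ^ 2)) := by
  obtain ⟨ψ, hψ, hψη⟩ := exists_measurePreserving_slicing hη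
  have hη0 : 0 < ‖η‖ := norm_pos_iff.2 hη
  have hψm := hψ.measurable
  have hwm : Measurable (gaussWeight D φ 0) := measurable_gaussWeight hD hφc
  set F := sliceIntegral ψ (gaussWeight D φ 0) with hF
  have hFm : Measurable F := measurable_sliceIntegral hψm hwm
  have hF1 : ∫⁻ s, F s = 1 := by rw [hF, lintegral_sliceIntegral hψ hwm, hprob]
  have hlc := sliceIntegral_logConcave hψm hwm (gaussWeight_logConcave le_rfl hφ)
  have hbd : ⨆ s, F s ≠ ⊤ := exists_bound_of_logConcave hFm hlc (by simp [hF1]) (by simp [hF1])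
  set M := (⨆ s, F s).toReal with hMdef
  have hMeq : ENNReal.ofReal M = ⨆ s, F s := ENNReal.ofReal_toReal hbd
  have hFM : ∀ s, F s ≤ ENNReal.ofReal M := fun s => hMeq ▸ le_iSup F s
  have hFt : ∀ s, F s ≠ ⊤ := fun s => ne_top_of_le_ne_top ENNReal.ofReal_ne_top (hFM s)
  have hM0 : 0 < M := by
    refine ENNReal.toReal_pos (fun h => ?_) hbd
    have : ∀ s, F s = 0 := by simpa using h
    simp [this] at hF1
  have hpM := mul_measure_sq_le_sliceIntegral hD hφ hφc hη hψ hψη hκ hA (by simp [hprob]) hM0 hFM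
    hp hpA
  obtain ⟨s₀, hs₀⟩ : ∃ s₀, M / 2 ≤ (F s₀).toReal := by
    have : ENNReal.ofReal (M / 2) < ⨆ s, F s := by
      rw [← hMeq]
      exact (ENNReal.ofReal_lt_ofReal_iff hM0).2 (by linarith)
    obtain ⟨s₀, h⟩ := lt_iSup_iff.1 this
    exact ⟨s₀, (ENNReal.ofReal_le_iff_le_toReal (hFt _)).1 h.le⟩
  have hsecond := (isLogConcave_toReal hFt hlc).lintegral_sq_mul_le
    (integrable_toReal_of_lintegral_ne_top hFm.aemeasurable (by simp [hF1]))
    (by rw [integral_toReal hFm.aemeasurable (.of_forall fun s => (hFt s).lt_top), hF1]; simp)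
    hM0 (fun s => ENNReal.toReal_le_of_le_ofReal hM0.le (hFM s)) hs₀
  simp only [ENNReal.ofReal_toReal (hFt _)] at hsecond
  rw [lintegral_mul_sliceIntegral hψ hwm (by fun_prop) (ℓ := fun x => inner ℝ η x / ‖η‖)
    (by fun_prop) (fun s y => by rw [hψη]; field_simp)] at hsecond
  refine ⟨‖η‖ * s₀, ?_⟩
  rw [lintegral_withDensity_eq_lintegral_mul _ hwm (by fun_prop)]
  calc _ = ENNReal.ofReal (‖η‖ ^ 2) * ∫⁻ x, ENNReal.ofReal ((inner ℝ η x / ‖η‖ - s₀) ^ 2) *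
        gaussWeight D φ 0 x := by
        rw [← lintegral_const_mul _ (by fun_prop)]
        refine lintegral_congr fun x => ?_
        rw [Pi.mul_apply, mul_comm, ← mul_assoc, ← ENNReal.ofReal_mul (by positivity), ← mul_pow]
        congr 3
        field_simp
    _ ≤ ENNReal.ofReal (‖η‖ ^ 2) * ENNReal.ofReal (32768 / M ^ 2) := by gcongr
    _ ≤ _ := by
      rw [← ENNReal.ofReal_mul (by positivity)]
      -- The bound on `M` reads `κ ‖η‖² p² ≤ 2⁷ M²`, and `2¹⁵ · 2⁷ = 2²²`.
      refine ENNReal.ofReal_le_ofReal ?_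
      rw [mul_div_assoc', div_le_div_iff₀ (by positivity) (by positivity)]
      nlinarith

/-- The mean minimises the second moment. If `Y` is not integrable, the second moment about `c` is
infinite. -/
theorem evariance_le_lintegral_sq_sub {Ω : Type*} [MeasurableSpace Ω] {P : Measure Ω}
    [IsProbabilityMeasure P] {Y : Ω → ℝ} (hY : AEStronglyMeasurable Y P) (c : ℝ) :
    eVar[Y; P] ≤ ∫⁻ ω, ENNReal.ofReal ((Y ω - c) ^ 2) ∂P := by
  have e : ∫⁻ ω, ENNReal.ofReal ((Y ω - c) ^ 2) ∂P = ∫⁻ ω, ‖Y ω - c‖ₑ ^ 2 ∂P := by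
    simp [← enorm_pow, Real.enorm_of_nonneg (sq_nonneg _)]
  have hYc : AEStronglyMeasurable (fun ω => Y ω - c) P := hY.sub aestronglyMeasurable_const
  rw [e]
  by_cases h : Integrable Y P
  · have h1 : eVar[Y; P] = eVar[fun ω => Y ω - c; P] := by
      simp only [evariance]
      rw [integral_sub h (integrable_const c)]
      simp
    rw [h1, evariance_def' hYc]
    exact tsub_le_self
  · have h2 : ¬ MemLp (fun ω => Y ω - c) 2 P := fun h2 => h (by
      refine ((h2.integrable (by norm_num)).add (integrable_const c)).congr (.of_forall fun ω => ?_)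
      simp)
    have h3 := evariance_eq_top hYc h2
    rw [evariance_def' hYc] at h3
    rw [ENNReal.sub_eq_top_iff.1 h3 |>.1]
    exact le_top

/-! ### Extended-valued convex functions and their Hessians. -/

section QuantileBrascampLieb

variable {n : ℕ} {f : EuclideanSpace ℝ (Fin n) → EReal}

theorem IsExtendedConvex.convexOn (hf : IsExtendedConvex f) :
    ConvexOn ℝ {x | f x ≠ ⊤} fun x => (f x).toReal := by
  have key : ∀ x, f x ≠ ⊤ → ∀ y, f y ≠ ⊤ → ∀ a b : ℝ, 0 < a → 0 < b → a + b = 1 →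
      f (a • x + b • y) ≤ ((a * (f x).toReal + b * (f y).toReal : ℝ) : EReal) := by
    intro x hx y hy a b ha hb hab
    have := hf.2 x y a b ha hb hab
    rwa [← EReal.coe_toReal hx (hf.1 x), ← EReal.coe_toReal hy (hf.1 y), ← EReal.coe_mul,
      ← EReal.coe_mul, ← EReal.coe_add] at this
  refine convexOn_iff_forall_pos.2
    ⟨convex_iff_forall_pos.2 fun x hx y hy a b ha hb hab => ?_, fun x hx y hy a b ha hb hab => ?_⟩
  · exact ne_top_of_le_ne_top (EReal.coe_ne_top _) (key x hx y hy a b ha hb hab)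
  · exact EReal.toReal_le_toReal (key x hx y hy a b ha hb hab) (hf.1 _) (EReal.coe_ne_top _)

theorem IsExtendedConvex.convexOn_interior (hf : IsExtendedConvex f) :
    ConvexOn ℝ (interior {x | f x ≠ ⊤}) fun x => (f x).toReal :=
  hf.convexOn.subset interior_subset hf.convexOn.1.interior

/-- The frontier of the convex set `{f < ∞}` is Lebesgue null, so the density may be restricted to
the open interior, where `f` is continuous. -/
theorem IsExtendedConvex.exp_neg_ae_eq (hf : IsExtendedConvex f) :
    (fun x => EReal.exp (-f x)) =ᵐ[volume]
      gaussWeight (interior {x | f x ≠ ⊤}) (fun x => (f x).toReal) 0 := by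
  have h0 : volume (frontier {x | f x ≠ ⊤}) = 0 := hf.convexOn.1.addHaar_frontier volume
  filter_upwards [measure_eq_zero_iff_ae_notMem.1 h0] with x hx
  by_cases hxD : x ∈ interior {x | f x ≠ ⊤}
  · rw [gaussWeight_of_mem hxD]
    have h1 : f x ≠ ⊤ := interior_subset (s := {x | f x ≠ ⊤}) hxD
    conv_lhs => rw [← EReal.coe_toReal h1 (hf.1 x), ← EReal.coe_neg, EReal.exp_coe]
    simp
  · rw [gaussWeight_of_notMem hxD]
    have h1 : f x = ⊤ := by
      by_contra h
      exact hx ⟨subset_closure h, hxD⟩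
    simp [h1]

/-- A lower bound for second differences of a convex function at a point with
`⟨η, (Hess f)⁻¹ η⟩ ≤ t`. -/
theorem IsExtendedConvex.second_difference_ge (hf : IsExtendedConvex f)
    {η z : EuclideanSpace ℝ (Fin n)} {t : ℝ≥0} (ht : 0 < t) (hz : invHessForm f η z ≤ t) :
    z ∈ interior {x | f x ≠ ⊤} ∧ ∀ δ > 0, ∀ᶠ u in 𝓝 0,
      2 * (1 / (4 * (t : ℝ))) * inner ℝ η u ^ 2 - δ * ‖u‖ ^ 2 ≤
        (f (z + u)).toReal + (f (z - u)).toReal - 2 * (f z).toReal := by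
  have ht' : (0 : ℝ) < t := ht
  -- Relaxing `t` to `2 t` makes the inequality strict, so that the infimum yields an actual Hessian
  -- `H` and a solution `ζ` of `H ζ = η`.
  have hlt : invHessForm f η z < ((2 * t : ℝ≥0) : ℝ≥0∞) := lt_of_le_of_lt hz (by
    exact_mod_cast (by linarith [ht'] : (t : ℝ) < 2 * t))
  simp only [invHessForm, invQuadForm, iInf_lt_iff] at hlt
  obtain ⟨H, ⟨hsymm, hfin, v, hexp⟩, ζ, hζ, hζt⟩ := hlt
  have hζt' : inner ℝ η ζ ≤ 2 * (t : ℝ) := by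
    rw [← ENNReal.ofReal_coe_nnreal, ENNReal.ofReal_lt_ofReal_iff (by positivity)] at hζt
    exact_mod_cast hζt.le
  have hzD : z ∈ interior {x | f x ≠ ⊤} :=
    mem_interior_iff_mem_nhds.2 (hfin.mono fun x hx => hx.1)
  set φ : EuclideanSpace ℝ (Fin n) → ℝ := fun x => (f x).toReal with hφ
  set T := Matrix.toEuclideanLin H with hT
  have hTs : ∀ u w, inner ℝ u (T w) = inner ℝ w (T u) := by
    intro u w
    have : T.IsSymmetric := Matrix.isSymmetric_toEuclideanLin_iff.2 (by
      rw [Matrix.IsHermitian, Matrix.conjTranspose_eq_transpose_of_trivial]; exact hsymm)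
    rw [real_inner_comm, this]
  -- second-order expansion of symmetric differences
  have hquad : ∀ δ > 0, ∀ᶠ u in 𝓝 (0 : EuclideanSpace ℝ (Fin n)),
      |φ (z + u) + φ (z - u) - 2 * φ z - inner ℝ u (T u)| ≤ δ * ‖u‖ ^ 2 := by
    intro δ hδ
    have h1 := hexp.def (half_pos hδ)
    have h2 : ∀ᶠ u in 𝓝 (0 : EuclideanSpace ℝ (Fin n)), _ :=
      (Continuous.tendsto' (f := fun u : EuclideanSpace ℝ (Fin n) => -u) (by fun_prop) 0 0
        (by simp)).eventually h1
    filter_upwards [h1, h2] with u h1 h2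
    simp only [inner_neg_left, map_neg, inner_neg_right, neg_neg, norm_neg, ← sub_eq_add_neg,
      Real.norm_eq_abs, abs_pow, abs_norm] at h1 h2
    rw [abs_le] at *
    constructor <;> simp only [hφ] <;> linarith [h1.1, h1.2, h2.1, h2.2]
  have hconv : ∀ᶠ u in 𝓝 (0 : EuclideanSpace ℝ (Fin n)), 0 ≤ φ (z + u) + φ (z - u) - 2 * φ z := by
    have hD := isOpen_interior.mem_nhds hzD
    have c1 : Filter.Tendsto (fun u => z + u) (𝓝 0) (𝓝 z) :=
      Continuous.tendsto' (by fun_prop) _ _ (by simp)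
    have c2 : Filter.Tendsto (fun u => z - u) (𝓝 0) (𝓝 z) :=
      Continuous.tendsto' (by fun_prop) _ _ (by simp)
    filter_upwards [c1 hD, c2 hD] with u h1 h2
    have := hf.convexOn_interior.2 h2 h1 (show (0 : ℝ) ≤ 1 / 2 by norm_num)
      (show (0 : ℝ) ≤ 1 / 2 by norm_num) (by norm_num)
    rw [show (1 / 2 : ℝ) • (z - u) + (1 / 2 : ℝ) • (z + u) = z by module] at this
    simp only [smul_eq_mul] at this
    simp only [hφ]
    linarith
  -- Positive semidefiniteness follows from convexity: insert `s u` into the expansion of the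
  -- symmetric difference, divide by `s²`, and let the error constant be arbitrarily small.
  have hpsd : ∀ u, 0 ≤ inner ℝ u (T u) := by
    intro u
    have hle : ∀ δ > 0, -(δ * ‖u‖ ^ 2) ≤ inner ℝ u (T u) := by
      intro δ hδ
      have c : Filter.Tendsto (fun s : ℝ => s • u) (𝓝[>] 0) (𝓝 0) :=
        (Continuous.tendsto' (by fun_prop) _ _ (by simp)).mono_left nhdsWithin_le_nhds
      obtain ⟨s, ⟨h1, h2⟩, hs⟩ :=
        ((c.eventually ((hquad δ hδ).and hconv)).and self_mem_nhdsWithin).exists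
      have hs : 0 < s := hs
      have h3 := (abs_le.1 h1).2
      rw [map_smul, inner_smul_left, inner_smul_right, norm_smul, Real.norm_of_nonneg hs.le] at h3
      simp only [conj_trivial] at h3
      have h4 : 0 ≤ s ^ 2 * (inner ℝ u (T u) + δ * ‖u‖ ^ 2) := by nlinarith
      have := nonneg_of_mul_nonneg_right h4 (by positivity)
      linarith
    rcases eq_or_ne u 0 with rfl | hu
    · simp
    by_contra! h
    have hu' : 0 < ‖u‖ ^ 2 := by positivity
    have := hle (-(inner ℝ u (T u)) / (2 * ‖u‖ ^ 2)) (div_pos (by linarith) (by positivity))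
    rw [div_mul_eq_mul_div, mul_div_mul_right _ _ hu'.ne'] at this
    linarith
  -- Cauchy–Schwarz for the form of `H`, proved by expanding it at `u + l ζ` with the `l` that is
  -- optimal when `⟨η, ζ⟩ = 2 t`.
  have hcs : ∀ u, 2 * (1 / (4 * (t : ℝ))) * inner ℝ η u ^ 2 ≤ inner ℝ u (T u) := by
    intro u
    set l := -(inner ℝ η u) / (2 * (t : ℝ)) with hl
    have h := hpsd (u + l • ζ)
    have e1 : inner ℝ u (T ζ) = inner ℝ η u := by rw [hζ, real_inner_comm]
    have e2 : inner ℝ ζ (T ζ) = inner ℝ η ζ := by rw [hζ, real_inner_comm]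
    have e3 : inner ℝ ζ (T u) = inner ℝ η u := by rw [hTs, e1]
    rw [map_add, map_smul, inner_add_left, inner_add_right, inner_add_right, inner_smul_left,
      inner_smul_left, inner_smul_right, inner_smul_right, e1, e2, e3] at h
    simp only [conj_trivial] at h
    have h5 : l * (l * inner ℝ η ζ) ≤ l ^ 2 * (2 * t) := by nlinarith [sq_nonneg l]
    have h6 : l * inner ℝ η u = -(inner ℝ η u ^ 2 / (2 * t)) := by rw [hl]; field_simp
    have h7 : l ^ 2 * (2 * t) = inner ℝ η u ^ 2 / (2 * t) := by rw [hl]; field_simp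
    have h8 : 2 * (1 / (4 * (t : ℝ))) * inner ℝ η u ^ 2 = inner ℝ η u ^ 2 / (2 * t) := by
      field_simp; ring
    linarith
  refine ⟨hzD, fun δ hδ => ?_⟩
  filter_upwards [hquad δ hδ] with u hu
  have := (abs_le.1 hu).1
  have := hcs u
  simp only [hφ] at *
  linarith

/-- Quantile Brascamp–Lieb inequality with a quadratic dependence on the probability. -/
theorem evariance_inner_le {Ω : Type*} [MeasurableSpace Ω] {P : Measure Ω}
    [IsProbabilityMeasure P] {X : Ω → EuclideanSpace ℝ (Fin n)} {η : EuclideanSpace ℝ (Fin n)}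
    (hf : IsExtendedConvex f) (hX : HasDensityExpNeg P X f) (hη : η ≠ 0) {t : ℝ≥0} (ht : 0 < t) :
    eVar[fun ω => inner ℝ η (X ω); P] ≤
      ((2 ^ 26 : ℝ≥0) : ℝ≥0∞) * t / P {ω | invHessForm f η (X ω) ≤ t} ^ 2 := by
  obtain ⟨hXm, hXd⟩ := hX
  rw [withDensity_congr_ae hf.exp_neg_ae_eq] at hXd
  have ht' : (0 : ℝ) < t := ht
  set Q := P {ω | invHessForm f η (X ω) ≤ t} with hQ
  rcases eq_or_ne Q 0 with h0 | hQ0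
  · rw [h0]
    simp [ENNReal.div_zero, ht.ne']
  have hQt : Q ≠ ⊤ := measure_ne_top _ _
  have hQpos : 0 < Q.toReal := ENNReal.toReal_pos hQ0 hQt
  obtain _ | m := n
  · exact absurd (Subsingleton.elim η 0) hη
  have hA : ENNReal.ofReal (Q.toReal / 2) <
      (volume.withDensity (gaussWeight (interior {x | f x ≠ ⊤}) (fun x => (f x).toReal) 0))
        {x | invHessForm f η x ≤ t} := by
    rw [← hXd]
    -- This inequality for image measures holds for arbitrary sets, so measurability of `invHessForm
    -- f η` is not needed. Halving `Q` provides the required strict inequality.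
    refine lt_of_lt_of_le ?_ (Measure.le_map_apply hXm _)
    exact (ENNReal.ofReal_lt_iff_lt_toReal (by positivity) hQt).2 (half_lt_self hQpos)
  have hone : ∫⁻ x, gaussWeight (interior {x | f x ≠ ⊤}) (fun x => (f x).toReal) 0 x = 1 := by
    have := Measure.isProbabilityMeasure_map (μ := P) hXm
    rw [← setLIntegral_univ, ← withDensity_apply _ MeasurableSet.univ, ← hXd, measure_univ]
  obtain ⟨c, hc⟩ := exists_lintegral_sq_le isOpen_interior hf.convexOn_interior
    (hf.convexOn_interior.continuousOn isOpen_interior) hη (by positivity)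
    (fun z hz => hf.second_difference_ge ht hz) hone (half_pos hQpos) hA
  rw [← hXd, lintegral_map' (by fun_prop) hXm] at hc
  have hYm : AEStronglyMeasurable (fun ω => inner ℝ η (X ω)) P :=
    (Measurable.comp_aemeasurable (g := fun x => inner ℝ η x) (by fun_prop) hXm).aestronglyMeasurable
  refine (evariance_le_lintegral_sq_sub hYm c).trans (hc.trans_eq ?_)
  -- The extra factor `2⁴` comes from `κ = 1 / (4 t)` and `p = Q / 2`.
  rw [show (2 : ℝ) ^ 22 / (1 / (4 * (t : ℝ)) * (Q.toReal / 2) ^ 2) = 2 ^ 26 * t / Q.toReal ^ 2 by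
    field_simp; ring, ENNReal.ofReal_div_of_pos (by positivity), ENNReal.ofReal_mul (by positivity),
    ENNReal.ofReal_pow hQpos.le, ENNReal.ofReal_toReal hQt, ENNReal.ofReal_coe_nnreal]
  congr 2
  rw [ENNReal.ofReal_pow (by norm_num)]
  simp

end QuantileBrascampLieb

/-! ### The cubic bound and the median bound. -/

theorem theorem1p1 :
    ∃ C : ℝ≥0, 0 < C ∧
      ∀ (n : ℕ) (Ω : Type*) [MeasurableSpace Ω] (P : Measure Ω) [IsProbabilityMeasure P]
        (X : Ω → EuclideanSpace ℝ (Fin n)) (f : EuclideanSpace ℝ (Fin n) → EReal)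
        (η : EuclideanSpace ℝ (Fin n)),
        IsExtendedConvex f → HasDensityExpNeg P X f → η ≠ 0 →
          (∀ t : ℝ≥0, 0 < t →
            eVar[fun ω => inner ℝ η (X ω); P] ≤
              (C : ℝ≥0∞) * t / P {ω | invHessForm f η (X ω) ≤ t} ^ 3) ∧
          ∀ m : ℝ≥0∞, IsMedian P (fun ω => invHessForm f η (X ω)) m →
            eVar[fun ω => inner ℝ η (X ω); P] ≤ 8 * (C : ℝ≥0∞) * m := by
  refine ⟨2 ^ 26, by positivity, fun n Ω _ P _ X f η hf hX hη => ?_⟩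
  have main : ∀ t : ℝ≥0, 0 < t → eVar[fun ω => inner ℝ η (X ω); P] ≤
      ((2 ^ 26 : ℝ≥0) : ℝ≥0∞) * t / P {ω | invHessForm f η (X ω) ≤ t} ^ 3 := fun t ht =>
    (evariance_inner_le hf hX hη ht).trans
      (ENNReal.div_le_div_left (pow_le_pow_right_of_le_one' prob_le_one (by norm_num)) _)
  refine ⟨main, fun m hm => ?_⟩
  induction m with
  | top => simp [ENNReal.mul_top]
  | coe m =>
    -- The quantile bound needs `t > 0` while the median may be `0`, so it is applied for `t > m`
    -- and `t` is then sent down to `m`.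
    have h1 : ∀ t : ℝ≥0, m < t → eVar[fun ω => inner ℝ η (X ω); P] ≤
        8 * ((2 ^ 26 : ℝ≥0) : ℝ≥0∞) * t := by
      intro t ht
      refine (main t (lt_of_le_of_lt bot_le ht)).trans ?_
      have h2 : 1 / 2 ≤ P {ω | invHessForm f η (X ω) ≤ t} :=
        hm.2.trans (measure_mono fun ω (hω : invHessForm f η (X ω) ≤ m) =>
          hω.trans (ENNReal.coe_le_coe.2 ht.le))
      have h3 : (1 / 8 : ℝ≥0∞) ≤ P {ω | invHessForm f η (X ω) ≤ t} ^ 3 := by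
        refine le_trans (le_of_eq ?_) (pow_le_pow_left' h2 3)
        rw [one_div, one_div, ← ENNReal.inv_pow]
        norm_num
      refine (ENNReal.div_le_div_left h3 _).trans_eq ?_
      rw [one_div, div_eq_mul_inv, inv_inv]
      ring
    have h4 : Filter.Tendsto (fun t : ℝ≥0 => 8 * ((2 ^ 26 : ℝ≥0) : ℝ≥0∞) * t) (𝓝[>] m)
        (𝓝 (8 * ((2 ^ 26 : ℝ≥0) : ℝ≥0∞) * m)) :=
      ENNReal.Tendsto.const_mul ((ENNReal.continuous_coe.tendsto m).mono_left nhdsWithin_le_nhds)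
        (.inr (ENNReal.mul_ne_top (by simp) ENNReal.coe_ne_top))
    exact ge_of_tendsto h4 (Filter.eventually_of_mem self_mem_nhdsWithin fun t ht => h1 t ht)
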